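/- Let $\mathcal P$ be a family of probability distributions on a measurable space $\mathcal X$. For probability measures $P,Q,M$ (with densities taken with respect to a common dominating measure, and the conventions $0/0=0$, $a/0=\infty$ for $a>0$) write $$\int\frac{(dP-dQ)^2}{dM},\qquad \chi^2(P\|Q)=\int\frac{(dP-dQ)^2}{dQ},\qquad H^2(P,Q)=\int(\sqrt{dP}-\sqrt{dQ})^2,\qquad \mathsf{TV}(P,Q)=\frac12\int|dP-dQ| .$$ Define the $\chi^2$ channel capacity, the $\chi^2$ diameter, the $H^2$ diameter and the maximum $H^2$ singularity of $\mathcal P$ by $$\mathsf C_{\chi^2}=\sup_{\rho}\mathbb E_{P\sim\rho}\big[\chi^2(P\,\|\,\mathbb E_{P'\sim\rho}[P'])\big],\quad \mathsf D_{\chi^2}=\sup_{P_1,P_2\in\mathcal P}\chi^2(P_1\|P_2),\quad \mathsf D_{H^2}=\sup_{P_1,P_2\in\mathcal P}H^2(P_1,P_2),\quad \mathsf\Delta_{H^2}=\Big(1-\frac{\mathsf D_{H^2}}2\Big)^{-2},$$ where $\rho$ ranges over all prior distributions on $\mathcal P$. Suppose that $\mathsf D_{\chi^2}<\infty$. Then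 $\mathsf C_{\chi^2}<\infty$ and $\mathsf\Delta_{H^2}<\infty$, and the following holds for all $n\ge2$ and all $P_1,\dots,P_n,Q_1,\dots,Q_n\in\mathcal P$ for which there is an index $i_0$ with $Q_i=P_i$ for every $i\ne i_0$. Let $$\mathbb P_n=\frac1{n!}\sum_{\pi\in S_n}\bigotimes_{i=1}^nP_{\pi(i)},\qquad \mathbb Q_n=\frac1{n!}\sum_{\pi\in S_n}\bigotimes_{i=1}^nQ_{\pi(i)},\qquad \overline P=\frac1{n-1}\sum_{i\ne i_0}P_i .$$ Then $$\mathsf{TV}(\mathbb P_n,\mathbb Q_n)^2\le\frac14\int\frac{(d\mathbb P_n-d\mathbb Q_n)^2}{d\overline P^{\otimes n}}\le\frac{3\,\mathsf D_{\chi^2}\,(e\,\mathsf\Delta_{H^2})^{3\mathsf C_{\chi^2}}}{n},$$ and every real-valued $f\in L^2(\overline P^{\otimes n})$ is integrable under $\mathbb P_n$ and $\mathbb Q_n$ and satisfies $$\big(\mathbb E_{\mathbb P_n}[f]-\mathbb E_{\mathbb Q_n}[f]\big)^2\le\mathbb E_{\overline P^{\otimes n}}[f^2]\cdot\frac{12\,\mathsf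 D_{\chi^2}\,(e\,\mathsf\Delta_{H^2})^{3\mathsf C_{\chi^2}}}{n}.$$ -/

import Mathlib

open MeasureTheory
open scoped ENNReal

namespace PermMix

/-- `∫ (dP - dQ)² / dM`, computed from the densities of `P`, `Q`, `M` with respect to the common
dominating measure `P + Q + M`, with the conventions `0 / 0 = 0` and `a / 0 = ∞` for `a > 0`.
(For finite measures the value does not depend on the dominating measure.) -/
noncomputable def sqDiffIntegral {X : Type*} [MeasurableSpace X] (P Q M : Measure X) : ℝ≥0∞ :=
  ∫⁻ x, ENNReal.ofReal
      (((P.rnDeriv (P + Q + M) x).toReal - (Q.rnDeriv (P + Q + M) x).toReal) ^ 2)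
    / M.rnDeriv (P + Q + M) x ∂(P + Q + M)

/-- The `χ²` divergence `χ²(P‖Q) = ∫ (dP - dQ)² / dQ`. -/
noncomputable def chiSq {X : Type*} [MeasurableSpace X] (P Q : Measure X) : ℝ≥0∞ :=
  sqDiffIntegral P Q Q

/-- The squared Hellinger distance `H²(P,Q) = ∫ (√dP - √dQ)²`. -/
noncomputable def hellingerSq {X : Type*} [MeasurableSpace X] (P Q : Measure X) : ℝ≥0∞ :=
  ∫⁻ x, ENNReal.ofReal
      ((√(P.rnDeriv (P + Q) x).toReal - √(Q.rnDeriv (P + Q) x).toReal) ^ 2) ∂(P + Q)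

/-- The total variation distance `TV(P,Q) = (1/2) ∫ |dP - dQ|`. -/
noncomputable def tvDist {X : Type*} [MeasurableSpace X] (P Q : Measure X) : ℝ≥0∞ :=
  (1 / 2) * ∫⁻ x, ENNReal.ofReal
      |(P.rnDeriv (P + Q) x).toReal - (Q.rnDeriv (P + Q) x).toReal| ∂(P + Q)

/-- The `χ²` mutual information `E_{ω ∼ ρ} [χ²(κ ω ‖ E_{ω' ∼ ρ} [κ ω'])]`. -/
noncomputable def chiSqInfo {X Ω : Type*} [MeasurableSpace X] [MeasurableSpace Ω]
    (ρ : Measure Ω) (κ : Ω → Measure X) : ℝ≥0∞ :=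
  ∫⁻ ω, chiSq (κ ω) (ρ.bind κ) ∂ρ

/-- The `χ²` channel capacity of a family `F` of probability distributions: the supremum of the
`χ²` mutual information over all prior distributions `ρ` on `F`. A prior is a probability measure
on `F` with respect to some σ-algebra for which all evaluations `P ↦ P B` (`B` measurable) are
measurable; this includes every finitely supported prior and every prior on the σ-algebra
generated by the evaluations. -/
noncomputable def chiSqCapacity {X : Type*} [MeasurableSpace X]
    (F : Set (ProbabilityMeasure X)) : ℝ≥0∞ :=
  ⨆ (m : MeasurableSpace F)
    (_ : Measurable[m] fun P : F => ((P : ProbabilityMeasure X) : Measure X))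
    (ρ : @Measure F m) (_ : @IsProbabilityMeasure F m ρ),
    @chiSqInfo X F _ m ρ fun P : F => ((P : ProbabilityMeasure X) : Measure X)

/-- The `χ²` diameter of a family of probability distributions. -/
noncomputable def chiSqDiam {X : Type*} [MeasurableSpace X]
    (F : Set (ProbabilityMeasure X)) : ℝ≥0∞ :=
  ⨆ P₁ ∈ F, ⨆ P₂ ∈ F, chiSq (P₁ : Measure X) (P₂ : Measure X)

/-- The `H²` diameter of a family of probability distributions. -/
noncomputable def hellingerSqDiam {X : Type*} [MeasurableSpace X]
    (F : Set (ProbabilityMeasure X)) : ℝ≥0∞ :=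
  ⨆ P₁ ∈ F, ⨆ P₂ ∈ F, hellingerSq (P₁ : Measure X) (P₂ : Measure X)

/-- The maximum `H²` singularity `(1 - D_{H²} / 2)⁻²` (infinite when `D_{H²} = 2`;
always `D_{H²} ≤ 2`, so that the subtraction does not truncate). -/
noncomputable def hellingerSingularity {X : Type*} [MeasurableSpace X]
    (F : Set (ProbabilityMeasure X)) : ℝ≥0∞ :=
  ((1 - hellingerSqDiam F / 2) ^ 2)⁻¹

/-- The permutation mixture `E_{π ∼ Unif(S_n)} [⊗ᵢ P_{π(i)}]`. -/
noncomputable def permMixture {X : Type*} [MeasurableSpace X] {n : ℕ}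
    (P : Fin n → ProbabilityMeasure X) : Measure (Fin n → X) :=
  (n.factorial : ℝ≥0∞)⁻¹ •
    ∑ π : Equiv.Perm (Fin n), Measure.pi fun i => (P (π i) : Measure X)

/-- The average `(n - 1)⁻¹ ∑_{i ≠ i₀} Pᵢ` of the components other than the one at `i₀`. -/
noncomputable def avgExcept {X : Type*} [MeasurableSpace X] {n : ℕ}
    (P : Fin n → ProbabilityMeasure X) (i₀ : Fin n) : Measure X :=
  ((n - 1 : ℕ) : ℝ≥0∞)⁻¹ • ∑ i ∈ Finset.univ.erase i₀, (P i : Measure X)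

end PermMix

/-! ### Complex Gaussian moments and permanents -/

namespace PermMix

open scoped ComplexConjugate

/-! Let μ be the average of the N = n - 1 common components, and p_i, q_i the densities of P_i, Q_i
with respect to μ. The difference of the two mixtures has the symmetrized product of functions d_i
as density with respect to μ^{⊗n}, where d_i = p_i for i ≠ i₀ and d_{i₀} = p_{i₀} - q_{i₀}
(`permAverage_sub`). Its second moment is 1/n! times the permanent of the Gram matrix of the d_i in
L²(μ) (`integral_permAverage_sq`). Everything reduces to bounding this permanent by N! times a
quantity independent of n, since N!/n! = 1/n.

By Wick's formula the permanent equals E ∏ |ℓ_i(z)|² for linear forms ℓ_i in independent standard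
complex Gaussians. AM-GM on the factors i ≠ i₀ replaces them by the N-th power of a quadratic form,
diagonal in a suitable basis, whose eigenvalues are those of the Gram matrix of the common densities
divided by N. The moment is then explicit (`sum_perm_prod_gram_le`). The constant function gives an
eigenvalue 1, but ℓ_{i₀} has no component along it because d_{i₀} integrates to 0. Discarding that
coordinate leaves geometric series in the other eigenvalues x_k, and hence the bound (1 - x_k)⁻¹ ∏_j
(1 - x_j)⁻¹ (`sum_perm_prod_shifted_gram_le`).

Two facts control the x_k. Their sum is the χ² information of the uniform prior on the common
components, so it is at most the capacity. Each is at most 1 - δ with δ = (1 - D_{H²}/2)²: by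
Cauchy–Schwarz ∫ p_i p_j dμ ≥ (∫ √(p_i p_j) dμ)² ≥ δ, and a symmetric matrix with constant row sums
and entries bounded below has a spectral gap (`quadratic_form_le_of_gap`). Since (1 - x)⁻¹ ≤ (e/δ)^x
on [0, 1 - δ], the product is exponential in the capacity.

Finiteness of the capacity comes from quasi-convexity of χ² in its second argument
(`chiSq_bind_le`), and D_{H²} < 2 from `hellingerSq_add_le`. The bounds on total variation and on
expectations are Cauchy–Schwarz. -/

theorem integral_fourier_haarAddCircle (n : ℤ) :
    ∫ θ : UnitAddCircle, (fourier n θ : ℂ) ∂AddCircle.haarAddCircle = if n = 0 then 1 else 0 := by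
  split_ifs with h
  · subst h
    simp
  · exact integral_eq_zero_of_add_right_eq_neg (μ := AddCircle.haarAddCircle)
      (fourier_add_half_inv_index h one_pos)

theorem integrable_rpow_mul_exp (s : ℝ) (hs : 0 ≤ s) :
    IntegrableOn (fun y : ℝ => Real.exp (-y) * y ^ s) (Set.Ioi 0) := by
  simpa using Real.GammaIntegral_convergent (s := s + 1) (by linarith)

/-- The law of the squared modulus of a standard complex Gaussian. -/
noncomputable def unitExp : Measure ℝ :=
  (volume.restrict (Set.Ioi (0 : ℝ))).withDensity
    fun y => ((Real.exp (-y)).toNNReal : ℝ≥0∞)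

theorem measurable_exp_neg_toNNReal : Measurable fun y : ℝ => (Real.exp (-y)).toNNReal := by
  fun_prop

theorem sqrt_pow_eq_rpow {y : ℝ} (hy : 0 ≤ y) (m : ℕ) : √y ^ m = y ^ ((m : ℝ) / 2) := by
  rw [Real.sqrt_eq_rpow, ← Real.rpow_natCast, ← Real.rpow_mul hy]
  congr 1
  ring

theorem integrable_sqrt_pow_unitExp (m : ℕ) : Integrable (fun y : ℝ => √y ^ m) unitExp := by
  rw [unitExp, integrable_withDensity_iff_integrable_smul measurable_exp_neg_toNNReal]
  refine (integrable_rpow_mul_exp ((m : ℝ) / 2) (by positivity)).congr ?_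
  filter_upwards [ae_restrict_mem measurableSet_Ioi] with y hy
  simp only [NNReal.smul_def, Real.coe_toNNReal _ (Real.exp_pos _).le, smul_eq_mul]
  rw [sqrt_pow_eq_rpow (le_of_lt hy)]

theorem integral_sqrt_pow_unitExp (a : ℕ) :
    ∫ y : ℝ, √y ^ (a + a) ∂unitExp = (a.factorial : ℝ) := by
  rw [unitExp, integral_withDensity_eq_integral_smul measurable_exp_neg_toNNReal,
    ← Real.Gamma_nat_eq_factorial, Real.Gamma_eq_integral (by positivity)]
  refine setIntegral_congr_fun measurableSet_Ioi fun y hy => ?_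
  simp only [NNReal.smul_def, Real.coe_toNNReal _ (Real.exp_pos _).le, smul_eq_mul]
  rw [sqrt_pow_eq_rpow (le_of_lt hy)]
  congr 2
  push_cast
  ring

instance : SFinite unitExp := by unfold unitExp; infer_instance

/-- A measure on `ℂ` with the moments of a standard complex Gaussian. -/
def HasGaussianMoments (ν : Measure ℂ) : Prop :=
  ∀ a b : ℕ, Integrable (fun z : ℂ => z ^ a * conj z ^ b) ν ∧
    ∫ z : ℂ, z ^ a * conj z ^ b ∂ν = if a = b then (a.factorial : ℂ) else 0

/-- Polar coordinates: take √y · e^{2πiθ} with y exponential and θ uniform. The angle kills the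
moments with a ≠ b, and the radius gives ∫ y^a e^{-y} dy = a!. Only these moments are ever used, so
no Gaussian density is needed. -/
theorem exists_hasGaussianMoments :
    ∃ ν : Measure ℂ, IsFiniteMeasure ν ∧ HasGaussianMoments ν := by
  set ψ : ℝ × UnitAddCircle → ℂ := fun p => (√p.1 : ℂ) * fourier 1 p.2 with hψ
  have hψm : Measurable ψ := by
    have h : Continuous ψ := by
      rw [hψ]
      fun_prop
    exact h.measurable
  have key : ∀ (a b : ℕ) (p : ℝ × UnitAddCircle), ψ p ^ a * conj (ψ p) ^ b
      = ((√p.1 ^ (a + b) : ℝ) : ℂ) * fourier ((a : ℤ) - b) p.2 := by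
    intro a b p
    have h1 : ∀ m : ℕ, (fourier 1 p.2 : ℂ) ^ m = fourier (m : ℤ) p.2 := by
      intro m
      induction m with
      | zero => simp
      | succ m ih => rw [pow_succ, ih, ← fourier_add]; push_cast; rfl
    rw [hψ]
    simp only [map_mul, Complex.conj_ofReal, mul_pow, ← map_pow, h1]
    rw [sub_eq_add_neg, fourier_add, fourier_neg]
    push_cast
    ring
  have hI : ∀ a b : ℕ, Integrable (fun z : ℂ => z ^ a * conj z ^ b)
      ((unitExp.prod AddCircle.haarAddCircle).map ψ) := by
    intro a b
    rw [integrable_map_measure (by fun_prop) hψm.aemeasurable]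
    have h2 : Integrable (fun θ : UnitAddCircle => (fourier ((a : ℤ) - b) θ : ℂ))
        AddCircle.haarAddCircle :=
      (map_continuous (fourier ((a : ℤ) - b))).integrable_of_hasCompactSupport
        (HasCompactSupport.of_compactSpace _)
    refine ((integrable_sqrt_pow_unitExp (a + b)).ofReal (𝕜 := ℂ) |>.mul_prod h2).congr ?_
    exact Filter.Eventually.of_forall fun p => (key a b p).symm
  refine ⟨(unitExp.prod AddCircle.haarAddCircle).map ψ, ?_, fun a b => ⟨hI a b, ?_⟩⟩
  -- The moment with a = b = 0 is the total mass, so its integrability is finiteness.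
  · have h := hI 0 0
    simp only [pow_zero, mul_one] at h
    exact (integrable_const_iff.mp h).resolve_left one_ne_zero
  · rw [integral_map hψm.aemeasurable (by fun_prop)]
    simp only [key]
    rw [integral_prod_mul (fun y : ℝ => ((√y ^ (a + b) : ℝ) : ℂ))
      (fun θ : UnitAddCircle => (fourier ((a : ℤ) - b) θ : ℂ)), integral_fourier_haarAddCircle,
      integral_complex_ofReal]
    split_ifs with h1 h2 h2
    · subst h2
      rw [integral_sqrt_pow_unitExp]
      simp
    · omega
    · omega
    · simp

variable {ι κ : Type*} [Fintype ι] [Fintype κ]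

section Moments

variable {ν : Measure ℂ} [IsFiniteMeasure ν]

theorem HasGaussianMoments.integrable_prod (hν : HasGaussianMoments ν) (a b : κ → ℕ) :
    Integrable (fun z : κ → ℂ => ∏ k, (z k ^ a k * conj (z k) ^ b k))
      (Measure.pi fun _ => ν) :=
  Integrable.fintype_prod (f := fun k z => z ^ a k * conj z ^ b k) fun _ => (hν _ _).1

theorem HasGaussianMoments.integral_prod (hν : HasGaussianMoments ν) (a b : κ → ℕ) :
    ∫ z : κ → ℂ, ∏ k, (z k ^ a k * conj (z k) ^ b k) ∂(Measure.pi fun _ => ν)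
      = if a = b then ((∏ k, (a k).factorial : ℕ) : ℂ) else 0 := by
  rw [integral_fintype_prod_eq_prod (fun k z => z ^ a k * conj z ^ b k)]
  simp only [(hν _ _).2]
  split_ifs with h
  · subst h
    simp
  · obtain ⟨k, hk⟩ := Function.ne_iff.mp h
    exact Finset.prod_eq_zero (Finset.mem_univ k) (if_neg hk)

theorem prod_comp_eq_prod_pow [DecidableEq κ] (f : ι → κ) (z : κ → ℂ) :
    ∏ i, z (f i) = ∏ k, z k ^ (Fintype.card {i // f i = k}) := by
  rw [← Finset.prod_fiberwise' Finset.univ f z]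
  refine Finset.prod_congr rfl fun k _ => ?_
  rw [Finset.prod_const, Fintype.card_subtype]

variable [DecidableEq ι] [DecidableEq κ]

/-- The number of permutations carrying one map to another. -/
theorem card_perm_comp_eq (f g : ι → κ) :
    (Finset.univ.filter fun σ : Equiv.Perm ι => f ∘ σ = g).card
      = if (fun k => Fintype.card {i // f i = k}) = fun k => Fintype.card {i // g i = k}
        then ∏ k, (Fintype.card {i // f i = k}).factorial else 0 := by
  split_ifs with h
  -- Matching the fibres produces one solution τ; all solutions then form a coset of the stabilizer
  -- of f, which permutes each fibre of f freely.
  · have e : ∀ k, {i // g i = k} ≃ {i // f i = k} := fun k =>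
      Fintype.equivOfCardEq (congrFun h k).symm
    let τ : Equiv.Perm ι := (Equiv.sigmaFiberEquiv g).symm.trans
      ((Equiv.sigmaCongrRight e).trans (Equiv.sigmaFiberEquiv f))
    have hτ : f ∘ τ = g := by
      funext i
      exact (e (g i) ⟨i, rfl⟩).2
    rw [← DomMulAct.stabilizer_card f, Fintype.card_subtype]
    refine Finset.card_bij' (fun σ _ => σ * τ⁻¹) (fun σ _ => σ * τ) ?_ ?_ ?_ ?_
    · intro σ hσ
      simp only [Finset.mem_filter, Finset.mem_univ, true_and] at hσ ⊢
      rw [Equiv.Perm.coe_mul, ← Function.comp_assoc, hσ, ← hτ, Function.comp_assoc,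
        ← Equiv.Perm.coe_mul, mul_inv_cancel]
      rfl
    · intro σ hσ
      simp only [Finset.mem_filter, Finset.mem_univ, true_and] at hσ ⊢
      rw [Equiv.Perm.coe_mul, ← Function.comp_assoc, hσ, hτ]
    · intro σ _
      simp
    · intro σ _
      simp
  · rw [Finset.card_eq_zero, Finset.filter_eq_empty_iff]
    intro σ _ hσ
    apply h
    funext k
    refine Fintype.card_congr ?_
    refine (Equiv.subtypeEquiv σ fun i => ?_).symm
    rw [← hσ]
    rfl

/-- Wick's formula for one monomial. -/
theorem HasGaussianMoments.integral_prod_comp (hν : HasGaussianMoments ν) (f g : ι → κ) :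
    Integrable (fun z : κ → ℂ => (∏ i, z (f i)) * ∏ i, conj (z (g i))) (Measure.pi fun _ => ν) ∧
    ∫ z : κ → ℂ, (∏ i, z (f i)) * ∏ i, conj (z (g i)) ∂(Measure.pi fun _ => ν)
      = ∑ σ : Equiv.Perm ι, if f ∘ σ = g then 1 else 0 := by
  have h : ∀ z : κ → ℂ, (∏ i, z (f i)) * ∏ i, conj (z (g i))
      = ∏ k, (z k ^ Fintype.card {i // f i = k} * conj (z k) ^ Fintype.card {i // g i = k}) := by
    intro z
    rw [prod_comp_eq_prod_pow f, prod_comp_eq_prod_pow g (fun k => conj (z k)),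
      Finset.prod_mul_distrib]
  simp only [h]
  refine ⟨hν.integrable_prod _ _, ?_⟩
  rw [hν.integral_prod, Finset.sum_boole, card_perm_comp_eq]
  split_ifs <;> simp

/-- Wick's formula: the permanent of a Gram matrix is a Gaussian moment. -/
theorem HasGaussianMoments.integral_prod_linear (hν : HasGaussianMoments ν) (B : ι → κ → ℂ) :
    ∫ z : κ → ℂ, (∏ i, ∑ k, B i k * z k) * ∏ i, ∑ k, B i k * conj (z k) ∂(Measure.pi fun _ => ν)
      = ∑ σ : Equiv.Perm ι, ∏ i, ∑ k, B i k * B (σ i) k := by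
  have h : ∀ z : κ → ℂ, (∏ i, ∑ k, B i k * z k) * ∏ i, ∑ k, B i k * conj (z k)
      = ∑ f : ι → κ, ∑ g : ι → κ, ((∏ i, B i (f i)) * ∏ i, B i (g i)) *
          ((∏ i, z (f i)) * ∏ i, conj (z (g i))) := by
    intro z
    rw [Finset.prod_univ_sum, Finset.prod_univ_sum, Finset.sum_mul_sum, Fintype.piFinset_univ]
    refine Finset.sum_congr rfl fun f _ => Finset.sum_congr rfl fun g _ => ?_
    rw [Finset.prod_mul_distrib, Finset.prod_mul_distrib]
    ring
  simp only [h]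
  rw [integral_finsetSum _ fun f _ => integrable_finsetSum _ fun g _ =>
    (hν.integral_prod_comp f g).1.const_mul _]
  simp_rw [integral_finsetSum _ fun g _ => (hν.integral_prod_comp _ g).1.const_mul _,
    integral_const_mul, (hν.integral_prod_comp _ _).2, Finset.mul_sum, mul_ite, mul_one, mul_zero]
  -- For fixed f and σ only g = f ∘ σ survives.
  have h2 : ∀ f : ι → κ, ∑ g : ι → κ, ∑ σ : Equiv.Perm ι,
      (if f ∘ σ = g then (∏ i, B i (f i)) * ∏ i, B i (g i) else 0)
      = ∑ σ : Equiv.Perm ι, ∏ i, (B (σ i) (f (σ i)) * B i (f (σ i))) := by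
    intro f
    rw [Finset.sum_comm]
    refine Finset.sum_congr rfl fun σ _ => ?_
    rw [Finset.sum_ite_eq, if_pos (Finset.mem_univ _), Finset.prod_mul_distrib,
      Equiv.prod_comp σ fun i => B i (f i)]
    rfl
  simp_rw [h2]
  rw [Finset.sum_comm]
  refine Finset.sum_congr rfl fun σ _ => ?_
  rw [Finset.prod_univ_sum, Fintype.piFinset_univ]
  refine Fintype.sum_equiv (Equiv.arrowCongr σ.symm (Equiv.refl κ)) _ _ fun f => ?_
  refine Finset.prod_congr rfl fun i _ => ?_
  simp [mul_comm]

end Moments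

end PermMix

/-! ### Bounding the permanent by complete homogeneous sums -/

namespace PermMix

open scoped ComplexConjugate

theorem prod_le_arith_mean_pow {ι : Type*} (s : Finset ι) (hs : s.Nonempty) (x : ι → ℝ)
    (hx : ∀ i ∈ s, 0 ≤ x i) : ∏ i ∈ s, x i ≤ ((∑ i ∈ s, x i) / s.card) ^ s.card := by
  have hc : 0 < s.card := Finset.card_pos.mpr hs
  have h := Real.geom_mean_le_arith_mean s (fun _ => 1) x (fun _ _ => zero_le_one)
    (by simpa using hc) hx
  simp only [Real.rpow_one, one_mul, Finset.sum_const, nsmul_eq_mul, mul_one] at h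
  have h0 : 0 ≤ ∏ i ∈ s, x i := Finset.prod_nonneg hx
  calc ∏ i ∈ s, x i = ((∏ i ∈ s, x i) ^ ((s.card : ℝ)⁻¹)) ^ s.card :=
        (Real.rpow_inv_natCast_pow h0 hc.ne').symm
    _ ≤ _ := pow_le_pow_left₀ (Real.rpow_nonneg h0 _) h _

section

variable {κ : Type*} [Fintype κ] [DecidableEq κ] {ν : Measure ℂ} [IsFiniteMeasure ν]

theorem prod_pow_add_single (α : κ → ℕ) (k : κ) (z : κ → ℂ) :
    ∏ j, z j ^ (α + Pi.single k 1 : κ → ℕ) j = z k * ∏ j, z j ^ α j := by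
  simp only [Pi.add_apply, pow_add, Finset.prod_mul_distrib]
  rw [mul_comm]
  congr 1
  simp [Pi.single_apply, pow_ite]

theorem prod_factorial_add_single (α : κ → ℕ) (k : κ) :
    ∏ j, ((α + Pi.single k 1 : κ → ℕ) j).factorial = (α k + 1) * ∏ j, (α j).factorial := by
  rw [← Finset.mul_prod_erase _ _ (Finset.mem_univ k),
    ← Finset.mul_prod_erase _ (fun j => (α j).factorial) (Finset.mem_univ k)]
  have h : ∏ j ∈ Finset.univ.erase k, ((α + Pi.single k 1 : κ → ℕ) j).factorial
      = ∏ j ∈ Finset.univ.erase k, (α j).factorial :=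
    Finset.prod_congr rfl fun j hj => by simp [Finset.ne_of_mem_erase hj]
  rw [h]
  simp only [Pi.add_apply, Pi.single_eq_same, Nat.factorial_succ]
  ring

/-- The moments of the product of a squared linear form and a power of a diagonal form. -/
theorem HasGaussianMoments.integral_linear_mul_diag_pow (hν : HasGaussianMoments ν)
    (c μ : κ → ℂ) (N : ℕ) :
    Integrable (fun z : κ → ℂ => (∑ k, c k * z k) * (∑ k, c k * conj (z k)) *
        (∑ k, μ k * (z k * conj (z k))) ^ N) (Measure.pi fun _ => ν) ∧
    ∫ z : κ → ℂ, (∑ k, c k * z k) * (∑ k, c k * conj (z k)) *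
        (∑ k, μ k * (z k * conj (z k))) ^ N ∂(Measure.pi fun _ => ν)
      = N.factorial * ∑ k, c k ^ 2 * ∑ α ∈ Finset.univ.piAntidiag N,
          (α k + 1) * ∏ j, μ j ^ α j := by
  have h : ∀ z : κ → ℂ, (∑ k, c k * z k) * (∑ k, c k * conj (z k)) *
        (∑ k, μ k * (z k * conj (z k))) ^ N
      = ∑ k, ∑ l, ∑ α ∈ Finset.univ.piAntidiag N,
        (c k * c l * (Nat.multinomial Finset.univ α * ∏ j, μ j ^ α j)) *
          ∏ j, (z j ^ (α + Pi.single k 1 : κ → ℕ) j * conj (z j) ^ (α + Pi.single l 1 : κ → ℕ) j) := by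
    intro z
    rw [Finset.sum_pow_eq_sum_piAntidiag, Finset.sum_mul_sum, Finset.sum_mul]
    refine Finset.sum_congr rfl fun k _ => ?_
    rw [Finset.sum_mul]
    refine Finset.sum_congr rfl fun l _ => ?_
    rw [Finset.mul_sum]
    refine Finset.sum_congr rfl fun α _ => ?_
    rw [Finset.prod_mul_distrib, prod_pow_add_single,
      prod_pow_add_single α l (fun j => conj (z j))]
    simp only [mul_pow, Finset.prod_mul_distrib]
    ring
  have hI := fun (k l : κ) (α : κ → ℕ) =>
    (hν.integrable_prod (α + Pi.single k 1) (α + Pi.single l 1)).const_mul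
      (c k * c l * (Nat.multinomial Finset.univ α * ∏ j, μ j ^ α j))
  simp only [h]
  have hI1 := fun k l => integrable_finsetSum (Finset.univ.piAntidiag N) fun α _ => hI k l α
  have hI2 := fun k => integrable_finsetSum Finset.univ fun l _ => hI1 k l
  refine ⟨integrable_finsetSum Finset.univ fun k _ => hI2 k, ?_⟩
  rw [integral_finsetSum _ fun k _ => hI2 k, Finset.mul_sum]
  refine Finset.sum_congr rfl fun k _ => ?_
  -- For l ≠ k the exponents of z and of its conjugate differ, so only l = k contributes; there the
  -- factorials of α cancel the multinomial coefficient down to N!, leaving α_k + 1.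
  rw [integral_finsetSum _ fun l _ => hI1 k l, Finset.sum_eq_single k]
  · rw [integral_finsetSum _ fun α _ => hI k k α, Finset.mul_sum, Finset.mul_sum]
    refine Finset.sum_congr rfl fun α hα => ?_
    rw [integral_const_mul, hν.integral_prod, if_pos rfl, prod_factorial_add_single]
    have hs : ((∏ j, (α j).factorial : ℕ) : ℂ) * Nat.multinomial Finset.univ α = N.factorial := by
      rw [← (Finset.mem_piAntidiag.mp hα).1]
      exact_mod_cast Nat.multinomial_spec Finset.univ α
    rw [← hs]
    push_cast
    ring
  · intro l _ hl
    rw [integral_finsetSum _ fun α _ => hI k l α]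
    refine Finset.sum_eq_zero fun α _ => ?_
    rw [integral_const_mul, hν.integral_prod, if_neg, mul_zero]
    intro he
    have h1 := congrFun he k
    simp [hl.symm] at h1
  · simp

end

section

variable {ι κ : Type*} [Fintype ι] [DecidableEq ι] [Fintype κ] [DecidableEq κ]

/-- Bound on the permanent of a Gram matrix by complete homogeneous sums in the eigenvalues
`μ` of the Gram matrix of all rows but one. -/
theorem sum_perm_prod_gram_le (i₀ : ι) (B : ι → κ → ℝ) (μ : κ → ℝ)
    (hN : (Finset.univ.erase i₀).Nonempty)
    (hB : ∀ k l, ∑ i ∈ Finset.univ.erase i₀, B i k * B i l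
      = if k = l then (Finset.univ.erase i₀).card * μ k else 0) :
    ∑ σ : Equiv.Perm ι, ∏ i, ∑ k, B i k * B (σ i) k
      ≤ (Finset.univ.erase i₀).card.factorial * ∑ k, B i₀ k ^ 2 *
        ∑ α ∈ Finset.univ.piAntidiag (Finset.univ.erase i₀).card,
          (α k + 1) * ∏ j, μ j ^ α j := by
  obtain ⟨ν, hνf, hν⟩ := exists_hasGaussianMoments
  set N := (Finset.univ.erase i₀).card with hNdef
  have hN0 : (N : ℝ) ≠ 0 := by
    have := Finset.card_pos.mpr hN
    positivity
  have hW : ∀ (z : κ → ℂ) (i : ι), (∑ k, (B i k : ℂ) * z k) * (∑ k, (B i k : ℂ) * conj (z k))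
      = ((Complex.normSq (∑ k, (B i k : ℂ) * z k) : ℝ) : ℂ) := by
    intro z i
    rw [← Complex.mul_conj, map_sum]
    simp
  -- Orthogonality of the columns removes the cross terms z_k · conj z_l.
  have hsum : ∀ z : κ → ℂ, ∑ i ∈ Finset.univ.erase i₀,
      Complex.normSq (∑ k, (B i k : ℂ) * z k) = N * ∑ k, μ k * Complex.normSq (z k) := by
    intro z
    rw [← Complex.ofReal_inj]
    push_cast
    simp_rw [← hW, ← Complex.mul_conj, Finset.sum_mul_sum]
    rw [Finset.sum_comm, Finset.mul_sum]
    refine Finset.sum_congr rfl fun k _ => ?_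
    rw [Finset.sum_comm, Finset.sum_eq_single k]
    · have h := congrArg (fun t : ℝ => (t : ℂ)) (hB k k)
      simp only [if_true] at h
      push_cast at h
      rw [← mul_assoc, ← h, Finset.sum_mul]
      exact Finset.sum_congr rfl fun i _ => by ring
    · intro l _ hl
      have h := congrArg (fun t : ℝ => (t : ℂ)) (hB k l)
      rw [if_neg hl.symm] at h
      push_cast at h
      calc ∑ i ∈ Finset.univ.erase i₀, (B i k : ℂ) * z k * ((B i l : ℂ) * conj (z l))
          = (∑ i ∈ Finset.univ.erase i₀, (B i k : ℂ) * B i l) * (z k * conj (z l)) := by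
            rw [Finset.sum_mul]
            exact Finset.sum_congr rfl fun i _ => by ring
        _ = 0 := by rw [h, zero_mul]
    · simp
  have hlin := hν.integral_prod_linear (fun i k => (B i k : ℂ))
  obtain ⟨hdI, hd⟩ := hν.integral_linear_mul_diag_pow (fun k => (B i₀ k : ℂ))
    (fun k => (μ k : ℂ)) N
  have e1 : ∀ z : κ → ℂ, (∏ i, ∑ k, (B i k : ℂ) * z k) * ∏ i, ∑ k, (B i k : ℂ) * conj (z k)
      = ((∏ i, Complex.normSq (∑ k, (B i k : ℂ) * z k) : ℝ) : ℂ) := by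
    intro z
    rw [← Finset.prod_mul_distrib]
    push_cast
    exact Finset.prod_congr rfl fun i _ => hW z i
  have e2 : ∀ z : κ → ℂ, (∑ k, (B i₀ k : ℂ) * z k) * (∑ k, (B i₀ k : ℂ) * conj (z k)) *
        (∑ k, (μ k : ℂ) * (z k * conj (z k))) ^ N
      = ((Complex.normSq (∑ k, (B i₀ k : ℂ) * z k) *
          (∑ k, μ k * Complex.normSq (z k)) ^ N : ℝ) : ℂ) := by
    intro z
    rw [hW]
    push_cast
    simp_rw [Complex.mul_conj]
  simp only [e1, integral_complex_ofReal] at hlin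
  simp only [e2] at hd hdI
  rw [integral_complex_ofReal] at hd
  have hdI' := hdI.re
  simp only [RCLike.re_to_complex, Complex.ofReal_re] at hdI'
  have hle : ∫ z : κ → ℂ, ∏ i, Complex.normSq (∑ k, (B i k : ℂ) * z k)
        ∂(Measure.pi fun _ => ν)
      ≤ ∫ z : κ → ℂ, Complex.normSq (∑ k, (B i₀ k : ℂ) * z k) *
          (∑ k, μ k * Complex.normSq (z k)) ^ N ∂(Measure.pi fun _ => ν) := by
    refine integral_mono_of_nonneg (Filter.Eventually.of_forall fun z =>
      Finset.prod_nonneg fun i _ => Complex.normSq_nonneg _) hdI'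
      (Filter.Eventually.of_forall fun z => ?_)
    simp only
    -- The factor at i₀ is kept intact and AM-GM is applied to the others, whose mean is the
    -- diagonal form.
    rw [← Finset.mul_prod_erase _ _ (Finset.mem_univ i₀)]
    refine mul_le_mul_of_nonneg_left ?_ (Complex.normSq_nonneg _)
    refine (prod_le_arith_mean_pow _ hN _ fun i _ => Complex.normSq_nonneg _).trans_eq ?_
    rw [hsum, ← hNdef, mul_div_cancel_left₀ _ hN0]
  have hlin' : ∫ z : κ → ℂ, ∏ i, Complex.normSq (∑ k, (B i k : ℂ) * z k)
      ∂(Measure.pi fun _ => ν) = ∑ σ : Equiv.Perm ι, ∏ i, ∑ k, B i k * B (σ i) k := by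
    rw [← Complex.ofReal_inj, hlin]
    push_cast
    rfl
  have hd' : ∫ z : κ → ℂ, Complex.normSq (∑ k, (B i₀ k : ℂ) * z k) *
          (∑ k, μ k * Complex.normSq (z k)) ^ N ∂(Measure.pi fun _ => ν)
      = N.factorial * ∑ k, B i₀ k ^ 2 *
        ∑ α ∈ Finset.univ.piAntidiag N, (α k + 1) * ∏ j, μ j ^ α j := by
    rw [← Complex.ofReal_inj, hd]
    push_cast
    rfl
  rw [← hlin', ← hd']
  exact hle

end

theorem sum_range_pow_le {x : ℝ} (hx : 0 ≤ x) (hx1 : x < 1) (N : ℕ) :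
    ∑ m ∈ Finset.range N, x ^ m ≤ (1 - x)⁻¹ :=
  sum_le_hasSum _ (fun m _ => pow_nonneg hx m) (hasSum_geometric_of_lt_one hx hx1)

theorem sum_range_succ_mul_pow_le {x : ℝ} (hx : 0 ≤ x) (hx1 : x < 1) (N : ℕ) :
    ∑ m ∈ Finset.range N, ((m : ℝ) + 1) * x ^ m ≤ (1 - x)⁻¹ * (1 - x)⁻¹ := by
  have h := hasSum_coe_mul_geometric_of_norm_lt_one (𝕜 := ℝ) (r := x)
    (by rwa [Real.norm_of_nonneg hx])
  have h' := hasSum_geometric_of_lt_one hx hx1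
  have h3 := h.add h'
  have h4 : x / (1 - x) ^ 2 + (1 - x)⁻¹ = (1 - x)⁻¹ * (1 - x)⁻¹ := by
    have : 1 - x ≠ 0 := by linarith
    field_simp
    ring
  rw [h4] at h3
  simp_rw [add_mul, one_mul]
  exact sum_le_hasSum _ (fun m _ => by positivity) h3

/-- The coordinate `none` has weight 1 and its exponent is determined by the others, so it can be
forgotten. What remains is a sum over exponents of total degree at most N; enlarging it to a box
makes it a product of truncated series, geometric for j ≠ k and ∑ (m + 1) x^m for j = k. -/
theorem sum_piAntidiag_option_le {κ : Type*} [Fintype κ] [DecidableEq κ] (μ : κ → ℝ)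
    (h0 : ∀ k, 0 ≤ μ k) (h1 : ∀ k, μ k < 1) (N : ℕ) (k : κ) :
    ∑ α ∈ (Finset.univ : Finset (Option κ)).piAntidiag N,
        ((α (some k) : ℝ) + 1) * ∏ j : Option κ, (j.elim 1 μ) ^ α j
      ≤ (1 - μ k)⁻¹ * ∏ j, (1 - μ j)⁻¹ := by
  let w : κ → ℕ → ℝ := fun j m => (if j = k then (m : ℝ) + 1 else 1) * μ j ^ m
  have hw0 : ∀ j m, 0 ≤ w j m := fun j m =>
    mul_nonneg (by split_ifs <;> positivity) (pow_nonneg (h0 j) m)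
  have hterm : ∀ α : Option κ → ℕ, ((α (some k) : ℝ) + 1) * ∏ j : Option κ, (j.elim 1 μ) ^ α j
      = ∏ j, w j (α (some j)) := by
    intro α
    rw [Fintype.prod_option, Finset.prod_mul_distrib]
    simp
  simp only [hterm]
  calc ∑ α ∈ (Finset.univ : Finset (Option κ)).piAntidiag N, ∏ j, w j (α (some j))
      = ∑ β ∈ ((Finset.univ : Finset (Option κ)).piAntidiag N).image (fun α j => α (some j)),
          ∏ j, w j (β j) := by
        rw [Finset.sum_image]
        intro α hα β hβ hαβ
        have hα' := (Finset.mem_piAntidiag.mp hα).1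
        have hβ' := (Finset.mem_piAntidiag.mp hβ).1
        have hs : ∀ j, α (some j) = β (some j) := fun j => congrFun hαβ j
        change ∑ j, α j = N at hα'
        change ∑ j, β j = N at hβ'
        rw [Fintype.sum_option] at hα' hβ'
        simp only [hs] at hα'
        funext j
        cases j with
        | none => omega
        | some j => exact hs j
    _ ≤ ∑ β ∈ Fintype.piFinset fun _ : κ => Finset.range (N + 1), ∏ j, w j (β j) := by
        refine Finset.sum_le_sum_of_subset_of_nonneg ?_ fun β _ _ =>
          Finset.prod_nonneg fun j _ => hw0 _ _
        intro β hβ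
        obtain ⟨α, hα, rfl⟩ := Finset.mem_image.mp hβ
        refine Fintype.mem_piFinset.mpr fun j => Finset.mem_range_succ_iff.mpr ?_
        rw [← (Finset.mem_piAntidiag.mp hα).1]
        exact Finset.single_le_sum (f := α) (fun _ _ => Nat.zero_le _) (Finset.mem_univ _)
    _ = ∏ j, ∑ m ∈ Finset.range (N + 1), w j m := (Finset.prod_univ_sum _ _).symm
    _ ≤ ∏ j, ((if j = k then (1 - μ k)⁻¹ else 1) * (1 - μ j)⁻¹) := by
        refine Finset.prod_le_prod (fun j _ => Finset.sum_nonneg fun m _ => hw0 _ _)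
          fun j _ => ?_
        by_cases hj : j = k
        · subst hj
          simpa [w] using sum_range_succ_mul_pow_le (h0 j) (h1 j) (N + 1)
        · simpa [w, hj] using sum_range_pow_le (h0 j) (h1 j) (N + 1)
    _ = _ := by
        rw [Finset.prod_mul_distrib]
        simp

/-- The permanent bound when the rows other than `i₀` have been shifted by a constant. -/
theorem sum_perm_prod_shifted_gram_le {ι κ : Type*} [Fintype ι] [DecidableEq ι] [Fintype κ]
    [DecidableEq κ] (i₀ : ι) (B : ι → κ → ℝ) (μ : κ → ℝ)
    (hN : (Finset.univ.erase i₀).Nonempty)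
    (hB : ∀ k l, ∑ i ∈ Finset.univ.erase i₀, B i k * B i l
      = if k = l then (Finset.univ.erase i₀).card * μ k else 0)
    (hB0 : ∀ k, ∑ i ∈ Finset.univ.erase i₀, B i k = 0)
    (h0 : ∀ k, 0 ≤ μ k) (h1 : ∀ k, μ k < 1) :
    ∑ σ : Equiv.Perm ι, ∏ i, ((if i = i₀ then 0 else 1) * (if σ i = i₀ then 0 else 1)
        + ∑ k, B i k * B (σ i) k)
      ≤ (Finset.univ.erase i₀).card.factorial *
        ∑ k, B i₀ k ^ 2 * ((1 - μ k)⁻¹ * ∏ j, (1 - μ j)⁻¹) := by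
  -- The constant shift is one more column, indexed by `none`: it is orthogonal to the others
  -- because they sum to zero off i₀, its eigenvalue is 1, and its entry in row i₀ is 0.
  have h := sum_perm_prod_gram_le i₀
    (fun i (k : Option κ) => k.elim (if i = i₀ then 0 else 1) (B i)) (fun k => k.elim 1 μ) hN ?_
  · simp only [Fintype.sum_option, Option.elim_none, Option.elim_some] at h
    refine h.trans ?_
    refine mul_le_mul_of_nonneg_left ?_ (by positivity)
    simp only [if_true, ne_eq, OfNat.ofNat_ne_zero, not_false_eq_true, zero_pow, zero_mul,
      zero_add]
    exact Finset.sum_le_sum fun k _ =>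
      mul_le_mul_of_nonneg_left (sum_piAntidiag_option_le μ h0 h1 _ k) (sq_nonneg _)
  · have hne : ∀ f : ι → ℝ, ∑ i ∈ Finset.univ.erase i₀, (if i = i₀ then 0 else 1) * f i
        = ∑ i ∈ Finset.univ.erase i₀, f i := fun f => Finset.sum_congr rfl fun i hi => by
      rw [if_neg (Finset.ne_of_mem_erase hi), one_mul]
    rintro (_ | k) (_ | l)
    · simp only [Option.elim_none, if_true, mul_one]
      rw [hne, Finset.sum_congr rfl fun i hi => if_neg (Finset.ne_of_mem_erase hi)]
      simp
    · simp only [Option.elim_none, Option.elim_some, reduceCtorEq, if_false]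
      rw [hne, hB0]
    · simp only [Option.elim_none, Option.elim_some, reduceCtorEq, if_false]
      simp_rw [mul_comm (B _ k)]
      rw [hne, hB0]
    · simp only [Option.elim_some, Option.some_inj]
      exact hB k l

end PermMix

/-! ### Diagonalization, spectral gap and the exponential bound -/

namespace PermMix

open scoped Matrix MatrixOrder in
/-- A positive semidefinite matrix factors through rows whose columns are orthogonal on a given
set of indices. -/
theorem exists_factor_orthogonal {ι : Type*} [Fintype ι] [DecidableEq ι] (Γ : Matrix ι ι ℝ)
    (hΓ : Γ.PosSemidef) (s : Finset ι) :
    ∃ (B : ι → ι → ℝ) (τ : ι → ℝ), (∀ i j, Γ i j = ∑ k, B i k * B j k) ∧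
      ∀ k l, ∑ i ∈ s, B i k * B i l = if k = l then τ k else 0 := by
  -- The factor is R V, where R = √Γ and V diagonalizes R E R, with E the coordinate projection onto
  -- s.
  set R := CFC.sqrt Γ with hR
  have hRR : R * R = Γ := by
    rw [← sq]
    exact CFC.sq_sqrt Γ hΓ.nonneg
  have hRH : Rᵀ = R := by
    have h := (Matrix.nonneg_iff_posSemidef.mp (CFC.sqrt_nonneg Γ)).isHermitian
    simpa [Matrix.IsHermitian, Matrix.conjTranspose_eq_transpose_of_trivial] using h
  let E : Matrix ι ι ℝ := Matrix.diagonal fun i => if i ∈ s then 1 else 0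
  have hS : (R * E * R).IsHermitian := by
    rw [Matrix.IsHermitian, Matrix.conjTranspose_eq_transpose_of_trivial, Matrix.transpose_mul,
      Matrix.transpose_mul, hRH, Matrix.diagonal_transpose, Matrix.mul_assoc]
  let V : Matrix ι ι ℝ := hS.eigenvectorUnitary
  have hVV : V * Vᵀ = 1 := by
    have h := Unitary.coe_mul_star_self hS.eigenvectorUnitary
    rwa [Unitary.coe_star, Matrix.star_eq_conjTranspose,
      Matrix.conjTranspose_eq_transpose_of_trivial] at h
  have hdiag : Vᵀ * (R * E * R) * V = Matrix.diagonal hS.eigenvalues := by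
    have h := hS.conjStarAlgAut_star_eigenvectorUnitary
    rw [Unitary.conjStarAlgAut_star_apply, Matrix.star_eq_conjTranspose,
      Matrix.conjTranspose_eq_transpose_of_trivial] at h
    exact h
  refine ⟨R * V, hS.eigenvalues, fun i j => ?_, fun k l => ?_⟩
  · have h : (R * V) * (R * V)ᵀ = Γ := by
      rw [Matrix.transpose_mul, hRH, Matrix.mul_assoc, ← Matrix.mul_assoc V, hVV,
        Matrix.one_mul, hRR]
    conv_lhs => rw [← h]
    rfl
  · have h : (R * V)ᵀ * E * (R * V) = Matrix.diagonal hS.eigenvalues := by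
      rw [← hdiag, Matrix.transpose_mul, hRH]
      simp only [Matrix.mul_assoc]
    have h2 := congrFun (congrFun h k) l
    rw [Matrix.diagonal_apply, Matrix.mul_apply] at h2
    rw [← h2]
    simp only [E, Matrix.mul_diagonal, Matrix.transpose_apply]
    rw [← Finset.sum_filter_add_sum_filter_not Finset.univ (· ∈ s)]
    simp only [Finset.filter_mem_eq_inter, Finset.univ_inter]
    have h3 : ∑ i ∈ Finset.univ.filter (· ∉ s), (R * V) i k * (if i ∈ s then 1 else 0) * (R * V) i l
        = 0 := Finset.sum_eq_zero fun i hi => by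
      rw [if_neg (Finset.mem_filter.mp hi).2]
      ring
    rw [h3, add_zero]
    exact Finset.sum_congr rfl fun i hi => by rw [if_pos hi, mul_one]

theorem one_sub_sum_le_prod_one_sub {κ : Type*} (s : Finset κ) (x : κ → ℝ)
    (h0 : ∀ k ∈ s, 0 ≤ x k) (h1 : ∀ k ∈ s, x k ≤ 1) :
    1 - ∑ k ∈ s, x k ≤ ∏ k ∈ s, (1 - x k) := by
  classical
  induction s using Finset.induction_on with
  | empty => simp
  | insert a s ha ih =>
    rw [Finset.sum_insert ha, Finset.prod_insert ha]
    have hs := ih (fun k hk => h0 k (Finset.mem_insert_of_mem hk))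
      (fun k hk => h1 k (Finset.mem_insert_of_mem hk))
    have ha0 := h0 a (Finset.mem_insert_self _ _)
    have ha1 := h1 a (Finset.mem_insert_self _ _)
    have hs0 : 0 ≤ ∑ k ∈ s, x k :=
      Finset.sum_nonneg fun k hk => h0 k (Finset.mem_insert_of_mem hk)
    nlinarith [mul_le_mul_of_nonneg_left hs (sub_nonneg.mpr ha1), mul_nonneg ha0 hs0]

/-- Split -log(1 - x) as -(1 - x) log(1 - x) - x log(1 - x). The first term is at most x, the second
at most -x log δ. -/
theorem inv_one_sub_le_rpow {x δ : ℝ} (hδ : 0 < δ) (hx0 : 0 ≤ x) (hx : x ≤ 1 - δ) :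
    (1 - x)⁻¹ ≤ (Real.exp 1 / δ) ^ x := by
  have hy : 0 < 1 - x := by linarith
  have hlog : Real.log δ ≤ Real.log (1 - x) := Real.log_le_log hδ (by linarith)
  have hinv := Real.one_sub_inv_le_log_of_pos hy
  rw [← Real.log_le_log_iff (inv_pos.mpr hy) (Real.rpow_pos_of_pos (by positivity) _),
    Real.log_inv, Real.log_rpow (by positivity), Real.log_div (by positivity) hδ.ne',
    Real.log_exp]
  have h1 : (1 - x) * (1 - (1 - x)⁻¹) ≤ (1 - x) * Real.log (1 - x) :=
    mul_le_mul_of_nonneg_left hinv hy.le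
  have h2 : (1 - x) * (1 - (1 - x)⁻¹) = -x := by field_simp; ring
  nlinarith [mul_le_mul_of_nonneg_left hlog hx0]

/-- Bound on the Gaussian moment factor in terms of the trace `C` and the spectral gap `δ`. -/
theorem inv_one_sub_mul_prod_le {κ : Type*} [Fintype κ] (x : κ → ℝ) {δ C : ℝ} (hδ : 0 < δ)
    (h0 : ∀ k, 0 ≤ x k) (h1 : ∀ k, x k ≤ 1 - δ) (hC : ∑ k, x k ≤ C) (k : κ) :
    (1 - x k)⁻¹ * ∏ j, (1 - x j)⁻¹ ≤ 3 * (Real.exp 1 / δ) ^ (3 * C) := by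
  have hδ1 : δ ≤ 1 := by linarith [h0 k, h1 k]
  have hkC : x k ≤ C := (Finset.single_le_sum (fun j _ => h0 j) (Finset.mem_univ k)).trans hC
  have hC0 : 0 ≤ C := (h0 k).trans hkC
  have hbase : Real.exp 1 ≤ Real.exp 1 / δ :=
    le_div_self (Real.exp_pos 1).le hδ hδ1
  have hbase1 : 1 ≤ Real.exp 1 / δ := by
    linarith [Real.add_one_le_exp (1 : ℝ)]
  have hpos : ∀ j, 0 < 1 - x j := fun j => by linarith [h1 j]
  -- The stray factor (1 - x_k)⁻¹ costs an exponent 1, absorbed by 1 + C ≤ 3C only when C ≥ 1/2. For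
  -- smaller C everything is at most (1 + 2C)² ≤ 3(1 + 3C), which is where the factor 3 is needed.
  rcases le_total C (1 / 2) with hc | hc
  · have hC1 : 0 < 1 - C := by linarith
    have hi : (1 - C)⁻¹ ≤ 1 + 2 * C := by
      rw [inv_le_iff_one_le_mul₀ hC1]
      nlinarith
    have hk : (1 - x k)⁻¹ ≤ 1 + 2 * C :=
      (inv_anti₀ hC1 (by linarith)).trans hi
    have hp : ∏ j, (1 - x j)⁻¹ ≤ 1 + 2 * C := by
      rw [Finset.prod_inv_distrib]
      refine (inv_anti₀ hC1 ?_).trans hi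
      have := one_sub_sum_le_prod_one_sub Finset.univ x (fun j _ => h0 j)
        fun j _ => by linarith [h1 j]
      linarith
    have he : 1 + 3 * C ≤ (Real.exp 1 / δ) ^ (3 * C) := by
      calc 1 + 3 * C ≤ Real.exp (3 * C) := by linarith [Real.add_one_le_exp (3 * C)]
        _ = Real.exp 1 ^ (3 * C) := by rw [← Real.exp_mul, one_mul]
        _ ≤ _ := Real.rpow_le_rpow (Real.exp_pos 1).le hbase (by linarith)
    have hm : (1 - x k)⁻¹ * ∏ j, (1 - x j)⁻¹ ≤ (1 + 2 * C) * (1 + 2 * C) :=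
      mul_le_mul hk hp (Finset.prod_nonneg fun j _ => (inv_pos.mpr (hpos j)).le) (by linarith)
    nlinarith
  · have hk : (1 - x k)⁻¹ ≤ Real.exp 1 / δ := by
      calc (1 - x k)⁻¹ ≤ δ⁻¹ := inv_anti₀ hδ (by linarith [h1 k])
        _ ≤ Real.exp 1 / δ := by
          rw [div_eq_mul_inv]
          exact le_mul_of_one_le_left (by positivity) (Real.one_le_exp zero_le_one)
    have hp : ∏ j, (1 - x j)⁻¹ ≤ (Real.exp 1 / δ) ^ C := by
      calc ∏ j, (1 - x j)⁻¹ ≤ ∏ j, (Real.exp 1 / δ) ^ x j :=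
            Finset.prod_le_prod (fun j _ => (inv_pos.mpr (hpos j)).le)
              fun j _ => inv_one_sub_le_rpow hδ (h0 j) (h1 j)
        _ = (Real.exp 1 / δ) ^ ∑ j, x j := by
            rw [Real.rpow_sum_of_pos (by positivity)]
        _ ≤ _ := Real.rpow_le_rpow_of_exponent_le hbase1 hC
    calc (1 - x k)⁻¹ * ∏ j, (1 - x j)⁻¹
        ≤ (Real.exp 1 / δ) * (Real.exp 1 / δ) ^ C :=
          mul_le_mul hk hp (Finset.prod_nonneg fun j _ => (inv_pos.mpr (hpos j)).le)
            (by positivity)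
      _ = (Real.exp 1 / δ) ^ (1 + C) := by
          rw [Real.rpow_add (by positivity), Real.rpow_one]
      _ ≤ (Real.exp 1 / δ) ^ (3 * C) :=
          Real.rpow_le_rpow_of_exponent_le hbase1 (by linarith)
      _ ≤ 3 * (Real.exp 1 / δ) ^ (3 * C) := by
          linarith [Real.rpow_nonneg (zero_le_one.trans hbase1) (3 * C)]

/-- Spectral gap of a nonnegative matrix with constant row sums. -/
theorem quadratic_form_le_of_gap {ι : Type*} (s : Finset ι) (Γ : ι → ι → ℝ) {δ : ℝ}
    (hsymm : ∀ i j, Γ i j = Γ j i) (hrow : ∀ i ∈ s, ∑ j ∈ s, Γ i j = 0)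
    (hgap : ∀ i ∈ s, ∀ j ∈ s, δ ≤ Γ i j + 1) (a : ι → ℝ) (ha : ∑ i ∈ s, a i = 0) :
    ∑ i ∈ s, ∑ j ∈ s, a i * a j * Γ i j ≤ s.card * (1 - δ) * ∑ i ∈ s, a i ^ 2 := by
  have h1 : ∑ i ∈ s, ∑ j ∈ s, a i ^ 2 * Γ i j = 0 := Finset.sum_eq_zero fun i hi => by
    rw [← Finset.mul_sum, hrow i hi, mul_zero]
  have h1' : ∑ i ∈ s, ∑ j ∈ s, a j ^ 2 * Γ i j = 0 := by
    rw [Finset.sum_comm, ← h1]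
    exact Finset.sum_congr rfl fun i _ => Finset.sum_congr rfl fun j _ => by rw [hsymm j i]
  have h2 : ∑ i ∈ s, ∑ j ∈ s, a i ^ 2 = s.card * ∑ i ∈ s, a i ^ 2 := by
    simp [Finset.mul_sum]
  have h2' : ∑ i ∈ s, ∑ j ∈ s, a j ^ 2 = s.card * ∑ i ∈ s, a i ^ 2 := by
    simp
  have h3 : ∑ i ∈ s, ∑ j ∈ s, a i * a j = 0 := by
    rw [← Finset.sum_mul_sum, ha, zero_mul]
  have hle : ∑ i ∈ s, ∑ j ∈ s, 2 * (a i * a j * Γ i j)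
      ≤ ∑ i ∈ s, ∑ j ∈ s, (a i ^ 2 * Γ i j + a j ^ 2 * Γ i j
        + (1 - δ) * (a i ^ 2 + a j ^ 2) - 2 * (1 - δ) * (a i * a j)) := by
    refine Finset.sum_le_sum fun i hi => Finset.sum_le_sum fun j hj => ?_
    -- This is (Γ_ij + 1 - δ)(a_i - a_j)² ≥ 0; after summation the vanishing row sums and ∑ a_i = 0
    -- leave only the two sides of the claim.
    nlinarith [mul_nonneg (sub_nonneg.mpr (hgap i hi j hj)) (sq_nonneg (a i - a j))]
  simp only [← Finset.mul_sum] at h1 h3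
  simp only [Finset.sum_add_distrib, Finset.sum_sub_distrib, ← Finset.mul_sum, h3, h2, h2',
    h1, h1', mul_add] at hle
  linarith

/-- The permanent bound in terms of a Gram matrix with trace and gap conditions. -/
theorem sum_perm_prod_le {ι : Type*} [Fintype ι] [DecidableEq ι] (i₀ : ι) (Γ : Matrix ι ι ℝ)
    (hΓ : Γ.PosSemidef) (hN : (Finset.univ.erase i₀).Nonempty) {δ C : ℝ} (hδ : 0 < δ)
    (hrow : ∀ i ∈ Finset.univ.erase i₀, ∑ j ∈ Finset.univ.erase i₀, Γ i j = 0)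
    (hgap : ∀ i ∈ Finset.univ.erase i₀, ∀ j ∈ Finset.univ.erase i₀, δ ≤ Γ i j + 1)
    (htr : ∑ i ∈ Finset.univ.erase i₀, Γ i i ≤ (Finset.univ.erase i₀).card * C) :
    ∑ σ : Equiv.Perm ι, ∏ i, ((if i = i₀ then 0 else 1) * (if σ i = i₀ then 0 else 1)
        + Γ i (σ i))
      ≤ (Finset.univ.erase i₀).card.factorial *
        (Γ i₀ i₀ * (3 * (Real.exp 1 / δ) ^ (3 * C))) := by
  set s := Finset.univ.erase i₀ with hs
  have hc : (0 : ℝ) < s.card := by exact_mod_cast Finset.card_pos.mpr hN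
  obtain ⟨B, τ, hB, hBs⟩ := exists_factor_orthogonal Γ hΓ s
  have hsymm : ∀ i j, Γ i j = Γ j i := fun i j => by
    rw [hB, hB]
    exact Finset.sum_congr rfl fun k _ => mul_comm _ _
  have hB0 : ∀ k, ∑ i ∈ s, B i k = 0 := by
    -- The left side is the sum of all entries of Γ over s × s.
    have h : ∑ k, (∑ i ∈ s, B i k) ^ 2 = 0 := by
      rw [← Finset.sum_eq_zero hrow]
      simp_rw [hB, sq, Finset.sum_mul_sum]
      rw [Finset.sum_comm]
      exact Finset.sum_congr rfl fun i _ => Finset.sum_comm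
    intro k
    have := (Finset.sum_eq_zero_iff_of_nonneg fun k _ => sq_nonneg _).mp h k (Finset.mem_univ k)
    exact pow_eq_zero_iff two_ne_zero |>.mp this
  have hτ : ∀ k, ∑ i ∈ s, B i k ^ 2 = τ k := fun k => by
    have := hBs k k
    simp only [if_true] at this
    rw [← this]
    exact Finset.sum_congr rfl fun i _ => sq _
  have hτ0 : ∀ k, 0 ≤ τ k := fun k => by
    rw [← hτ]
    positivity
  have hτ1 : ∀ k, τ k ≤ s.card * (1 - δ) := by
    intro k
    -- If τ_k = 0 only δ ≤ 1 is needed, and it holds because Γ_ij + 1 averages to 1 over s × s.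
    -- Otherwise column k of B is the test vector: the form takes the value τ_k² on it, and one
    -- factor τ_k cancels.
    rcases (hτ0 k).eq_or_lt with h | h
    · rw [← h]
      refine mul_nonneg hc.le ?_
      have hle : ∑ i ∈ s, ∑ j ∈ s, δ ≤ ∑ i ∈ s, ∑ j ∈ s, (Γ i j + 1) :=
        Finset.sum_le_sum fun i hi => Finset.sum_le_sum fun j hj => hgap i hi j hj
      simp only [Finset.sum_add_distrib, Finset.sum_eq_zero hrow, Finset.sum_const,
        nsmul_eq_mul, zero_add, mul_one] at hle
      have : (s.card : ℝ) * s.card * (1 - δ) ≥ 0 := by linarith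
      exact nonneg_of_mul_nonneg_right this (by positivity)
    · have hq := quadratic_form_le_of_gap s Γ hsymm hrow hgap (fun i => B i k) (hB0 k)
      rw [hτ] at hq
      have hq' : ∑ i ∈ s, ∑ j ∈ s, B i k * B j k * Γ i j = τ k ^ 2 := by
        have : ∑ l, (∑ i ∈ s, B i k * B i l) ^ 2 = τ k ^ 2 := by
          simp [hBs]
        rw [← this]
        simp_rw [hB, sq, Finset.sum_mul_sum, Finset.mul_sum]
        rw [Finset.sum_comm]
        simp_rw [Finset.sum_comm (s := Finset.univ) (t := s)]
        rw [Finset.sum_comm]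
        refine Finset.sum_congr rfl fun i _ => Finset.sum_congr rfl fun j _ =>
          Finset.sum_congr rfl fun l _ => by ring
      rw [hq'] at hq
      nlinarith
  have hx : ∀ k l, ∑ i ∈ s, B i k * B i l = if k = l then s.card * (τ k / s.card) else 0 := by
    intro k l
    rw [hBs, mul_div_cancel₀ _ hc.ne']
  have h0 : ∀ k, 0 ≤ τ k / s.card := fun k => div_nonneg (hτ0 k) hc.le
  have h1 : ∀ k, τ k / s.card ≤ 1 - δ := fun k => by
    rw [div_le_iff₀ hc]
    linarith [hτ1 k]
  have hsum : ∑ k, τ k / s.card ≤ C := by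
    rw [← Finset.sum_div, div_le_iff₀ hc]
    refine le_trans (le_of_eq ?_) (htr.trans_eq (mul_comm _ _))
    simp_rw [← hτ, hB]
    rw [Finset.sum_comm]
    exact Finset.sum_congr rfl fun i _ => Finset.sum_congr rfl fun k _ => sq _
  have hmain := sum_perm_prod_shifted_gram_le i₀ B (fun k => τ k / s.card) hN hx hB0 h0
    fun k => by linarith [h1 k]
  simp_rw [← hB] at hmain
  refine hmain.trans (mul_le_mul_of_nonneg_left ?_ (by positivity))
  rw [hB i₀ i₀, Finset.sum_mul]
  refine Finset.sum_le_sum fun k _ => ?_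
  rw [← sq]
  exact mul_le_mul_of_nonneg_left (inv_one_sub_mul_prod_le _ hδ h0 h1 hsum k) (sq_nonneg _)

end PermMix

/-! ### Divergences: change of dominating measure, duality, finiteness -/

namespace PermMix

variable {X : Type*} [MeasurableSpace X]

/-- The integrand is homogeneous of degree one in the three densities, including under the
conventions for division by 0; this makes the integral independent of the dominating measure. -/
theorem mul_ofReal_sq_div_eq {a b c s : ℝ≥0∞} (hs : s ≠ ∞) :
    s * (ENNReal.ofReal ((a.toReal - b.toReal) ^ 2) / c)
      = ENNReal.ofReal (((a * s).toReal - (b * s).toReal) ^ 2) / (c * s) := by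
  rcases eq_or_ne s 0 with rfl | h0
  · simp
  · have h : ((a * s).toReal - (b * s).toReal) ^ 2
        = (a.toReal - b.toReal) ^ 2 * (s.toReal * s.toReal) := by
      rw [ENNReal.toReal_mul, ENNReal.toReal_mul]
      ring
    rw [h, ENNReal.ofReal_mul (sq_nonneg _), ENNReal.ofReal_mul ENNReal.toReal_nonneg,
      ENNReal.ofReal_toReal hs, div_eq_mul_inv, div_eq_mul_inv,
      ENNReal.mul_inv (Or.inr hs) (Or.inr h0)]
    calc s * (ENNReal.ofReal ((a.toReal - b.toReal) ^ 2) * c⁻¹)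
        = ENNReal.ofReal ((a.toReal - b.toReal) ^ 2) * c⁻¹ * s * 1 := by ring
      _ = ENNReal.ofReal ((a.toReal - b.toReal) ^ 2) * c⁻¹ * s * (s * s⁻¹) := by
          rw [ENNReal.mul_inv_cancel h0 hs]
      _ = _ := by ring

theorem sqDiffIntegral_eq (P Q M μ : Measure X) [IsFiniteMeasure P] [IsFiniteMeasure Q]
    [IsFiniteMeasure M] [SigmaFinite μ] (hP : P ≪ μ) (hQ : Q ≪ μ) (hM : M ≪ μ) :
    sqDiffIntegral P Q M = ∫⁻ x, ENNReal.ofReal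
      (((P.rnDeriv μ x).toReal - (Q.rnDeriv μ x).toReal) ^ 2) / M.rnDeriv μ x ∂μ := by
  have hν : P + Q + M ≪ μ := (hP.add_left hQ).add_left hM
  have hPν : P ≪ P + Q + M := by
    rw [add_assoc]
    exact Measure.AbsolutelyContinuous.rfl.add_right _
  have hQν : Q ≪ P + Q + M := by
    rw [add_comm P Q, add_assoc]
    exact Measure.AbsolutelyContinuous.rfl.add_right _
  have hMν : M ≪ P + Q + M := by
    rw [add_comm]
    exact Measure.AbsolutelyContinuous.rfl.add_right _
  rw [sqDiffIntegral, ← lintegral_rnDeriv_mul hν (by fun_prop)]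
  refine lintegral_congr_ae ?_
  filter_upwards [Measure.rnDeriv_mul_rnDeriv (κ := μ) hPν, Measure.rnDeriv_mul_rnDeriv (κ := μ) hQν,
    Measure.rnDeriv_mul_rnDeriv (κ := μ) hMν, Measure.rnDeriv_lt_top (P + Q + M) μ]
    with x h1 h2 h3 h4
  rw [← h1, ← h2, ← h3]
  exact mul_ofReal_sq_div_eq h4.ne

theorem hellingerSq_eq (P Q μ : Measure X) [IsFiniteMeasure P] [IsFiniteMeasure Q]
    [SigmaFinite μ] (hP : P ≪ μ) (hQ : Q ≪ μ) :
    hellingerSq P Q = ∫⁻ x, ENNReal.ofReal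
      ((√(P.rnDeriv μ x).toReal - √(Q.rnDeriv μ x).toReal) ^ 2) ∂μ := by
  have hPν : P ≪ P + Q := Measure.AbsolutelyContinuous.rfl.add_right _
  have hQν : Q ≪ P + Q := by
    rw [add_comm]
    exact Measure.AbsolutelyContinuous.rfl.add_right _
  rw [hellingerSq, ← lintegral_rnDeriv_mul (hP.add_left hQ) (by fun_prop)]
  refine lintegral_congr_ae ?_
  filter_upwards [Measure.rnDeriv_mul_rnDeriv (κ := μ) hPν, Measure.rnDeriv_mul_rnDeriv (κ := μ) hQν,
    Measure.rnDeriv_lt_top (P + Q) μ] with x h1 h2 h4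
  rw [← h1, ← h2]
  simp only [Pi.mul_apply, ENNReal.toReal_mul, Real.sqrt_mul ENNReal.toReal_nonneg]
  rw [← sub_mul, mul_pow, Real.sq_sqrt ENNReal.toReal_nonneg, ENNReal.ofReal_mul (sq_nonneg _),
    ENNReal.ofReal_toReal h4.ne, mul_comm]

theorem tvDist_eq (P Q μ : Measure X) [IsFiniteMeasure P] [IsFiniteMeasure Q]
    [SigmaFinite μ] (hP : P ≪ μ) (hQ : Q ≪ μ) :
    tvDist P Q = (1 / 2) * ∫⁻ x, ENNReal.ofReal
      |(P.rnDeriv μ x).toReal - (Q.rnDeriv μ x).toReal| ∂μ := by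
  have hPν : P ≪ P + Q := Measure.AbsolutelyContinuous.rfl.add_right _
  have hQν : Q ≪ P + Q := by
    rw [add_comm]
    exact Measure.AbsolutelyContinuous.rfl.add_right _
  rw [tvDist, ← lintegral_rnDeriv_mul (hP.add_left hQ) (by fun_prop)]
  congr 1
  refine lintegral_congr_ae ?_
  filter_upwards [Measure.rnDeriv_mul_rnDeriv (κ := μ) hPν, Measure.rnDeriv_mul_rnDeriv (κ := μ) hQν,
    Measure.rnDeriv_lt_top (P + Q) μ] with x h1 h2 h4
  rw [← h1, ← h2]
  simp only [Pi.mul_apply, ENNReal.toReal_mul]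
  rw [← sub_mul, abs_mul, abs_of_nonneg (ENNReal.toReal_nonneg (a := (P + Q).rnDeriv μ x)),
    ENNReal.ofReal_mul (abs_nonneg _), ENNReal.ofReal_toReal h4.ne, mul_comm]

/-- When both measures are dominated by the reference measure, no division is needed. -/
theorem sqDiffIntegral_eq_of_ac (P Q μ : Measure X) [IsFiniteMeasure P] [IsFiniteMeasure Q]
    [IsFiniteMeasure μ] (hP : P ≪ μ) (hQ : Q ≪ μ) :
    sqDiffIntegral P Q μ = ∫⁻ x, ENNReal.ofReal
      (((P.rnDeriv μ x).toReal - (Q.rnDeriv μ x).toReal) ^ 2) ∂μ := by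
  rw [sqDiffIntegral_eq P Q μ μ hP hQ Measure.AbsolutelyContinuous.rfl]
  refine lintegral_congr_ae ?_
  filter_upwards [Measure.rnDeriv_self μ] with x hx
  rw [hx, div_one]

theorem chiSq_eq_of_ac (P Q : Measure X) [IsFiniteMeasure P] [IsFiniteMeasure Q] (hP : P ≪ Q) :
    chiSq P Q = ∫⁻ x, ENNReal.ofReal (((P.rnDeriv Q x).toReal - 1) ^ 2) ∂Q := by
  rw [chiSq, sqDiffIntegral_eq_of_ac P Q Q hP Measure.AbsolutelyContinuous.rfl]
  refine lintegral_congr_ae ?_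
  filter_upwards [Measure.rnDeriv_self Q] with x hx
  rw [hx, ENNReal.toReal_one]

/-- Where dQ vanishes and dP does not, the convention a / 0 = ∞ makes the integrand infinite, so
this set is null. -/
theorem absolutelyContinuous_of_chiSq_ne_top (P Q : Measure X) [IsFiniteMeasure P]
    [IsFiniteMeasure Q] (h : chiSq P Q ≠ ∞) : P ≪ Q := by
  have hP : P ≪ P + Q := Measure.AbsolutelyContinuous.rfl.add_right _
  have hQ : Q ≪ P + Q := by
    rw [add_comm]
    exact Measure.AbsolutelyContinuous.rfl.add_right _
  rw [chiSq, sqDiffIntegral_eq P Q Q (P + Q) hP hQ hQ] at h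
  have hfin := ae_lt_top (by fun_prop) h
  have hzero : ∀ᵐ x ∂(P + Q), Q.rnDeriv (P + Q) x = 0 → P.rnDeriv (P + Q) x = 0 := by
    filter_upwards [hfin, Measure.rnDeriv_lt_top P (P + Q)] with x hx hx1 hx0
    by_contra hne
    rw [hx0, ENNReal.toReal_zero, sub_zero, ENNReal.div_zero] at hx
    · exact lt_irrefl _ hx
    · have := ENNReal.toReal_pos hne hx1.ne
      rw [ne_eq, ENNReal.ofReal_eq_zero, not_le]
      positivity
  refine Measure.AbsolutelyContinuous.mk fun s hs hs0 => ?_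
  have h1 : ∀ᵐ x ∂((P + Q).restrict s), Q.rnDeriv (P + Q) x = 0 := by
    have := Measure.setLIntegral_rnDeriv hQ s
    rw [hs0, lintegral_eq_zero_iff (by fun_prop)] at this
    exact this
  rw [← Measure.setLIntegral_rnDeriv hP s, lintegral_eq_zero_iff (by fun_prop)]
  filter_upwards [h1, ae_restrict_of_ae hzero] with x hx hx'
  exact hx' hx

theorem sq_lintegral_mul_le (μ : Measure X) {f g : X → ℝ≥0∞} (hf : AEMeasurable f μ)
    (hg : AEMeasurable g μ) :
    (∫⁻ x, f x * g x ∂μ) ^ 2 ≤ (∫⁻ x, f x ^ 2 ∂μ) * ∫⁻ x, g x ^ 2 ∂μ := by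
  have h := ENNReal.lintegral_mul_norm_pow_le (hf.pow_const 2) (hg.pow_const 2)
    (p := 1 / 2) (q := 1 / 2) (by norm_num) (by norm_num) (by norm_num)
  have hr : ∀ a : ℝ≥0∞, (a ^ 2) ^ (1 / 2 : ℝ) = a := fun a => by
    rw [← ENNReal.rpow_natCast, ← ENNReal.rpow_mul]
    norm_num
  have hr' : ∀ a : ℝ≥0∞, (a ^ (1 / 2 : ℝ)) ^ 2 = a := fun a => by
    rw [← ENNReal.rpow_natCast, ← ENNReal.rpow_mul]
    norm_num
  simp only [hr] at h
  calc _ ≤ _ := pow_le_pow_left' h 2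
    _ = _ := by rw [mul_pow, hr', hr']

theorem lintegral_rnDeriv_sq (P Q : Measure X) [IsProbabilityMeasure P] [IsProbabilityMeasure Q]
    (hP : P ≪ Q) : ∫⁻ x, P.rnDeriv Q x ^ 2 ∂Q = 1 + chiSq P Q := by
  have hpt : ∀ᵐ x ∂Q, P.rnDeriv Q x ^ 2 + 1
      = ENNReal.ofReal (((P.rnDeriv Q x).toReal - 1) ^ 2) + 2 * P.rnDeriv Q x := by
    filter_upwards [Measure.rnDeriv_lt_top P Q] with x hx
    lift P.rnDeriv Q x to NNReal using hx.ne with a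
    have h : (a : ℝ≥0∞) ^ 2 + 1 = ENNReal.ofReal ((a : ℝ) ^ 2 + 1) := by
      rw [ENNReal.ofReal_add (by positivity) zero_le_one, ENNReal.ofReal_pow (by positivity)]
      simp
    have h2 : 2 * (a : ℝ≥0∞) = ENNReal.ofReal (2 * (a : ℝ)) := by
      rw [ENNReal.ofReal_mul zero_le_two]
      simp
    rw [h, h2, ← ENNReal.ofReal_add (sq_nonneg _) (by positivity)]
    congr 1
    simp only [ENNReal.coe_toReal]
    ring
  have h := lintegral_congr_ae hpt
  rw [lintegral_add_right _ measurable_const, lintegral_add_right _ (by fun_prop),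
    lintegral_const_mul _ (by fun_prop), Measure.lintegral_rnDeriv hP, ← chiSq_eq_of_ac P Q hP,
    lintegral_const, measure_univ, measure_univ, mul_one, mul_one] at h
  have h2 : (∫⁻ x, P.rnDeriv Q x ^ 2 ∂Q) + 1 = 1 + chiSq P Q + 1 := by
    rw [h, ← one_add_one_eq_two]
    ring
  exact (ENNReal.add_left_inj ENNReal.one_ne_top).mp h2

/-- Dual characterization of the `χ²` divergence. -/
theorem chiSq_le_iff (P Q : Measure X) [IsProbabilityMeasure P] [IsProbabilityMeasure Q]
    {D : ℝ≥0∞} (hD : D ≠ ∞) :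
    chiSq P Q ≤ D ↔ ∀ g : X → ℝ≥0∞, Measurable g →
      (∫⁻ x, g x ∂P) ^ 2 ≤ (1 + D) * ∫⁻ x, g x ^ 2 ∂Q := by
  constructor
  · intro h g hg
    have hP := absolutelyContinuous_of_chiSq_ne_top P Q (ne_top_of_le_ne_top hD h)
    rw [← lintegral_rnDeriv_mul hP hg.aemeasurable]
    refine (sq_lintegral_mul_le Q (by fun_prop) hg.aemeasurable).trans ?_
    rw [lintegral_rnDeriv_sq P Q hP]
    gcongr
  · intro h
    -- Tested on the indicator of a Q-null set.
    have hP : P ≪ Q := by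
      refine Measure.AbsolutelyContinuous.mk fun s hs hs0 => ?_
      have := h (s.indicator 1) (measurable_one.indicator hs)
      have h2 : ∀ x, s.indicator (1 : X → ℝ≥0∞) x ^ 2 = s.indicator 1 x := fun x => by
        by_cases hx : x ∈ s <;> simp [hx]
      simp only [h2, lintegral_indicator_one hs, hs0, mul_zero] at this
      exact pow_eq_zero_iff two_ne_zero |>.mp (le_antisymm this zero_le)
    -- The extremal g is dP/dQ itself; truncating it at k keeps the integral A finite, so that A² ≤
    -- (1 + D) A can be divided by A. Monotone convergence removes the truncation.
    have hk : ∀ k : ℕ, ∫⁻ x, P.rnDeriv Q x * min (P.rnDeriv Q x) k ∂Q ≤ 1 + D := by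
      intro k
      have hm : Measurable fun x => min (P.rnDeriv Q x) (k : ℝ≥0∞) := by fun_prop
      have h1 := h _ hm
      rw [← lintegral_rnDeriv_mul hP hm.aemeasurable] at h1
      have h2 : ∫⁻ x, min (P.rnDeriv Q x) (k : ℝ≥0∞) ^ 2 ∂Q
          ≤ ∫⁻ x, P.rnDeriv Q x * min (P.rnDeriv Q x) k ∂Q := by
        refine lintegral_mono fun x => ?_
        simp only [sq]
        gcongr
        exact min_le_left _ _
      set A := ∫⁻ x, P.rnDeriv Q x * min (P.rnDeriv Q x) k ∂Q with hA
      have hAtop : A ≠ ∞ := by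
        refine ne_top_of_le_ne_top (ENNReal.natCast_ne_top k) ?_
        calc A ≤ ∫⁻ x, P.rnDeriv Q x * k ∂Q := lintegral_mono fun x => by
              gcongr
              exact min_le_right _ _
          _ = k := by
              rw [lintegral_mul_const _ (by fun_prop), Measure.lintegral_rnDeriv hP, measure_univ,
                one_mul]
      rcases eq_or_ne A 0 with h0 | h0
      · rw [h0]
        exact zero_le
      · have h3 : A * A ≤ (1 + D) * A := by
          rw [← sq]
          exact h1.trans (by gcongr)
        exact (ENNReal.mul_le_mul_iff_left h0 hAtop).mp h3
    have hsup : ∫⁻ x, P.rnDeriv Q x ^ 2 ∂Q ≤ 1 + D := by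
      have h1 : ∀ x, P.rnDeriv Q x ^ 2 = ⨆ k : ℕ, P.rnDeriv Q x * min (P.rnDeriv Q x) k := by
        intro x
        rw [← ENNReal.mul_iSup, ← inf_iSup_eq, ENNReal.iSup_natCast, inf_top_eq, sq]
      simp only [h1]
      rw [lintegral_iSup (fun k => by fun_prop)]
      · exact iSup_le hk
      · intro k l hkl x
        simp only
        gcongr
    rw [lintegral_rnDeriv_sq P Q hP] at hsup
    exact (ENNReal.add_le_add_iff_left ENNReal.one_ne_top).mp hsup

theorem isProbabilityMeasure_bind {Ω : Type*} [MeasurableSpace Ω] (ρ : Measure Ω)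
    [IsProbabilityMeasure ρ] {κ : Ω → Measure X} (hκ : Measurable κ)
    (h : ∀ ω, IsProbabilityMeasure (κ ω)) : IsProbabilityMeasure (ρ.bind κ) :=
  ⟨by simp [Measure.bind_apply MeasurableSet.univ hκ.aemeasurable]⟩

/-- The `χ²` divergence is quasi-convex in its second argument. -/
theorem chiSq_bind_le {Ω : Type*} [MeasurableSpace Ω] (ρ : Measure Ω)
    [IsProbabilityMeasure ρ] {κ : Ω → Measure X} (hκ : Measurable κ)
    (h : ∀ ω, IsProbabilityMeasure (κ ω)) (P : Measure X) [IsProbabilityMeasure P]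
    {D : ℝ≥0∞} (hD : D ≠ ∞) (hP : ∀ ω, chiSq P (κ ω) ≤ D) : chiSq P (ρ.bind κ) ≤ D := by
  have := isProbabilityMeasure_bind ρ hκ h
  rw [chiSq_le_iff _ _ hD]
  intro g hg
  -- In the dual form the second measure enters linearly, so the inequalities for the κ ω can be
  -- averaged over ρ.
  rw [Measure.lintegral_bind hκ.aemeasurable (by fun_prop),
    ← lintegral_const_mul' _ _ (ENNReal.add_ne_top.mpr ⟨ENNReal.one_ne_top, hD⟩)]
  calc (∫⁻ x, g x ∂P) ^ 2 = ∫⁻ _, (∫⁻ x, g x ∂P) ^ 2 ∂ρ := by simp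
    _ ≤ _ := lintegral_mono fun ω => (chiSq_le_iff _ _ hD).mp (hP ω) g hg

theorem chiSqCapacity_le_chiSqDiam (F : Set (ProbabilityMeasure X)) (hD : chiSqDiam F ≠ ∞) :
    chiSqCapacity F ≤ chiSqDiam F := by
  refine iSup_le fun m => iSup_le fun hm => iSup_le fun ρ => iSup_le fun hρ => ?_
  rw [chiSqInfo]
  calc _ ≤ ∫⁻ _, chiSqDiam F ∂ρ := lintegral_mono fun P =>
        chiSq_bind_le ρ hm (fun P => inferInstance) _ hD fun P' => ?_
    _ = chiSqDiam F := by simp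
  exact le_iSup₂_of_le P.1 P.2 (le_iSup₂_of_le P'.1 P'.2 le_rfl)

/-- With a = dP/dQ one has √a ≥ εa - ε³a². Integrating (√a - 1)² = a + 1 - 2√a and using ∫ a² dQ = 1
+ χ² ≤ 1 + D gives at most 2 - 2ε + 2ε³(1 + D) ≤ 2 - ε. -/
theorem hellingerSq_add_le (P Q : Measure X) [IsProbabilityMeasure P] [IsProbabilityMeasure Q]
    {D ε : ℝ} (hε : 0 < ε) (hεD : ε ^ 2 * (1 + D) ≤ 1 / 2) (hD : 0 ≤ D)
    (h : chiSq P Q ≤ ENNReal.ofReal D) : hellingerSq P Q ≤ ENNReal.ofReal (2 - ε) := by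
  have hP := absolutelyContinuous_of_chiSq_ne_top P Q (ne_top_of_le_ne_top ENNReal.ofReal_ne_top h)
  rw [hellingerSq_eq P Q Q hP Measure.AbsolutelyContinuous.rfl]
  have hpt : ∀ᵐ x ∂Q, ENNReal.ofReal
      ((√(P.rnDeriv Q x).toReal - √(Q.rnDeriv Q x).toReal) ^ 2)
        + ENNReal.ofReal (2 * ε) * P.rnDeriv Q x
      ≤ (P.rnDeriv Q x + 1) + ENNReal.ofReal (2 * ε ^ 3) * P.rnDeriv Q x ^ 2 := by
    filter_upwards [Measure.rnDeriv_lt_top P Q, Measure.rnDeriv_self Q] with x hx hx1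
    rw [hx1]
    lift P.rnDeriv Q x to NNReal using hx.ne with a
    obtain ⟨t, ht0, hta⟩ : ∃ t : ℝ, 0 ≤ t ∧ (a : ℝ) = t ^ 2 :=
      ⟨√a, Real.sqrt_nonneg _, (Real.sq_sqrt a.2).symm⟩
    have ha : (a : ℝ≥0∞) = ENNReal.ofReal (t ^ 2) := by
      rw [← hta]
      simp
    simp only [ENNReal.coe_toReal, hta, ENNReal.toReal_one, Real.sqrt_one, Real.sqrt_sq ht0]
    rw [ha, ← ENNReal.ofReal_one, ← ENNReal.ofReal_mul (by positivity),
      ← ENNReal.ofReal_pow (by positivity), ← ENNReal.ofReal_mul (by positivity),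
      ← ENNReal.ofReal_add (by positivity) (by positivity),
      ← ENNReal.ofReal_add (by positivity) (by positivity),
      ← ENNReal.ofReal_add (by positivity) (by positivity)]
    refine ENNReal.ofReal_le_ofReal ?_
    have hs : ε * t - (ε * t) ^ 3 ≤ 1 := by
      have h0 : 0 ≤ ε * t := by positivity
      rcases le_total (ε * t) 1 with h1 | h1
      · nlinarith [pow_nonneg h0 3]
      · nlinarith [mul_nonneg h0 (sub_nonneg.mpr h1), mul_nonneg (mul_nonneg h0 h0) (sub_nonneg.mpr h1)]
    nlinarith [mul_le_mul_of_nonneg_left hs ht0]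
  have hi := lintegral_mono_ae hpt
  rw [lintegral_add_right _ (by fun_prop), lintegral_add_right _ (by fun_prop),
    lintegral_add_right _ (by fun_prop), lintegral_const_mul _ (by fun_prop),
    lintegral_const_mul _ (by fun_prop), Measure.lintegral_rnDeriv hP, lintegral_rnDeriv_sq P Q hP,
    lintegral_const, measure_univ, measure_univ, mul_one, mul_one] at hi
  have h1 : ENNReal.ofReal (2 * ε ^ 3) * (1 + chiSq P Q) ≤ ENNReal.ofReal ε := by
    calc _ ≤ ENNReal.ofReal (2 * ε ^ 3) * (1 + ENNReal.ofReal D) := by gcongr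
      _ = ENNReal.ofReal (2 * ε ^ 3 * (1 + D)) := by
          rw [ENNReal.ofReal_mul (p := 2 * ε ^ 3) (by positivity), ENNReal.ofReal_add zero_le_one hD,
            ENNReal.ofReal_one]
      _ ≤ _ := ENNReal.ofReal_le_ofReal (by nlinarith)
  have hε2 : ε ≤ 2 := by nlinarith
  have h2 : ENNReal.ofReal (2 - ε) + ENNReal.ofReal (2 * ε)
      = 1 + 1 + ENNReal.ofReal ε := by
    rw [← ENNReal.ofReal_add (by linarith) (by positivity), ← ENNReal.ofReal_one,
      ← ENNReal.ofReal_add zero_le_one zero_le_one,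
      ← ENNReal.ofReal_add (by norm_num) hε.le]
    congr 1
    ring
  refine (ENNReal.add_le_add_iff_right (ENNReal.ofReal_ne_top (r := 2 * ε))).mp ?_
  rw [h2]
  exact hi.trans (by gcongr)

theorem hellingerSqDiam_lt_two (F : Set (ProbabilityMeasure X)) (hD : chiSqDiam F ≠ ∞) :
    hellingerSqDiam F < 2 := by
  set D := (chiSqDiam F).toReal with hDdef
  have hD0 : 0 ≤ D := ENNReal.toReal_nonneg
  -- The value giving equality in ε²(1 + D) ≤ 1/2.
  set ε := (√(2 * (1 + D)))⁻¹ with hε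
  have hε0 : 0 < ε := by positivity
  have hεD : ε ^ 2 * (1 + D) ≤ 1 / 2 := by
    rw [hε, inv_pow, Real.sq_sqrt (by positivity)]
    field_simp
    rfl
  have hle : hellingerSqDiam F ≤ ENNReal.ofReal (2 - ε) := by
    refine iSup₂_le fun P hP => iSup₂_le fun Q hQ =>
      hellingerSq_add_le _ _ hε0 hεD hD0 ?_
    rw [hDdef, ENNReal.ofReal_toReal hD]
    exact le_iSup₂_of_le P hP (le_iSup₂_of_le Q hQ le_rfl)
  refine hle.trans_lt ?_
  rw [ENNReal.ofReal_lt_iff_lt_toReal (by nlinarith) ENNReal.ofNat_ne_top]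
  simpa using hε0

theorem hellingerSingularity_eq (F : Set (ProbabilityMeasure X)) (hD : chiSqDiam F ≠ ∞) :
    0 < 1 - (hellingerSqDiam F).toReal / 2 ∧ hellingerSingularity F
      = ENNReal.ofReal ((1 - (hellingerSqDiam F).toReal / 2) ^ 2)⁻¹ := by
  have h := hellingerSqDiam_lt_two F hD
  have hne : hellingerSqDiam F ≠ ∞ := h.ne_top
  have h2 : (hellingerSqDiam F).toReal < 2 := by
    have := (ENNReal.toReal_lt_toReal hne ENNReal.ofNat_ne_top).mpr h
    simpa using this
  have hpos : 0 < 1 - (hellingerSqDiam F).toReal / 2 := by linarith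
  refine ⟨hpos, ?_⟩
  rw [hellingerSingularity, ENNReal.ofReal_inv_of_pos (by positivity),
    ENNReal.ofReal_pow hpos.le, ENNReal.ofReal_sub _ (by positivity), ENNReal.ofReal_one,
    ENNReal.ofReal_div_of_pos zero_lt_two, ENNReal.ofReal_toReal hne]
  simp

end PermMix

/-! ### Square-integrable densities and Cauchy–Schwarz -/

namespace PermMix

variable {X : Type*} [MeasurableSpace X]

section General

theorem sq_integral_mul_le (μ : Measure X) {f g : X → ℝ} (hf : MemLp f 2 μ) (hg : MemLp g 2 μ) :
    (∫ x, f x * g x ∂μ) ^ 2 ≤ (∫ x, f x ^ 2 ∂μ) * ∫ x, g x ^ 2 ∂μ := by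
  have hfg : Integrable (fun x => f x * g x) μ := hf.integrable_mul hg
  have hq : ∀ t : ℝ, 0 ≤ (∫ x, g x ^ 2 ∂μ) * (t * t) + (2 * ∫ x, f x * g x ∂μ) * t
      + ∫ x, f x ^ 2 ∂μ := by
    intro t
    have h : ∫ x, (f x + t * g x) ^ 2 ∂μ = (∫ x, g x ^ 2 ∂μ) * (t * t)
        + (2 * ∫ x, f x * g x ∂μ) * t + ∫ x, f x ^ 2 ∂μ := by
      have e : ∀ x, (f x + t * g x) ^ 2 = f x ^ 2 + (2 * t) * (f x * g x) + t ^ 2 * g x ^ 2 :=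
        fun x => by ring
      simp only [e]
      have h1 : Integrable (fun x => f x ^ 2 + (2 * t) * (f x * g x)) μ :=
        hf.integrable_sq.add (hfg.const_mul _)
      rw [integral_add h1 (hg.integrable_sq.const_mul _),
        integral_add hf.integrable_sq (hfg.const_mul _), integral_const_mul, integral_const_mul]
      ring
    rw [← h]
    exact integral_nonneg fun x => sq_nonneg _
  have := discrim_le_zero hq
  rw [discrim] at this
  nlinarith

theorem tvDist_sq_le (P Q μ : Measure X) [IsFiniteMeasure P] [IsFiniteMeasure Q]
    [IsProbabilityMeasure μ] (hP : P ≪ μ) (hQ : Q ≪ μ) :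
    tvDist P Q ^ 2 ≤ (1 / 4) * sqDiffIntegral P Q μ := by
  rw [tvDist_eq P Q μ hP hQ, sqDiffIntegral_eq_of_ac P Q μ hP hQ, mul_pow]
  have h := sq_lintegral_mul_le μ (f := fun x => ENNReal.ofReal
      |(P.rnDeriv μ x).toReal - (Q.rnDeriv μ x).toReal|) (g := fun _ => 1)
      (by fun_prop) (by fun_prop)
  simp only [mul_one, one_pow, lintegral_const, measure_univ,
    ← ENNReal.ofReal_pow (abs_nonneg _), sq_abs] at h
  have h4 : (1 / 2 : ℝ≥0∞) ^ 2 = 1 / 4 := by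
    simp only [one_div, ← ENNReal.inv_pow]
    norm_num
  rw [h4]
  gcongr

theorem pi_withDensity_ofReal {ι : Type*} [Fintype ι] (μ : Measure X) [IsFiniteMeasure μ]
    (f : ι → X → ℝ) (hf : ∀ i, Integrable (f i) μ) (hf0 : ∀ i x, 0 ≤ f i x) :
    Measure.pi (fun i => μ.withDensity fun x => ENNReal.ofReal (f i x))
      = (Measure.pi fun _ : ι => μ).withDensity fun x => ENNReal.ofReal (∏ i, f i (x i)) := by
  have hfin : ∀ i, IsFiniteMeasure (μ.withDensity fun x => ENNReal.ofReal (f i x)) := fun i =>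
    isFiniteMeasure_withDensity_ofReal (hf i).2
  refine Measure.pi_eq fun s hs => ?_
  rw [withDensity_apply _ (MeasurableSet.univ_pi hs), Measure.restrict_pi_pi,
    ← ofReal_integral_eq_lintegral_ofReal
      (Integrable.fintype_prod fun i => (hf i).mono_measure Measure.restrict_le_self)
      (Filter.Eventually.of_forall fun x => Finset.prod_nonneg fun i _ => hf0 i _),
    integral_fintype_prod_eq_prod,
    ENNReal.ofReal_prod_of_nonneg fun i _ => integral_nonneg fun x => hf0 i x]
  refine Finset.prod_congr rfl fun i _ => ?_
  rw [withDensity_apply _ (hs i), ofReal_integral_eq_lintegral_ofReal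
    ((hf i).mono_measure Measure.restrict_le_self) (Filter.Eventually.of_forall (hf0 i))]

theorem withDensity_ofReal_eq (P μ : Measure X) [IsFiniteMeasure P] [SigmaFinite μ]
    (h : P ≪ μ) : (μ.withDensity fun x => ENNReal.ofReal (P.rnDeriv μ x).toReal) = P := by
  conv_rhs => rw [← Measure.withDensity_rnDeriv_eq P μ h]
  refine withDensity_congr_ae ?_
  filter_upwards [Measure.rnDeriv_lt_top P μ] with x hx
  exact ENNReal.ofReal_toReal hx.ne

/-- Integration against a measure with a square-integrable density. -/
theorem integrable_and_integral_withDensity {μ : Measure X} {ρ f : X → ℝ} (hρ : MemLp ρ 2 μ)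
    (hρm : Measurable ρ) (hρ0 : ∀ x, 0 ≤ ρ x) (hf : MemLp f 2 μ) :
    Integrable f (μ.withDensity fun x => ENNReal.ofReal (ρ x)) ∧
    ∫ x, f x ∂(μ.withDensity fun x => ENNReal.ofReal (ρ x)) = ∫ x, ρ x * f x ∂μ := by
  have hm : Measurable fun x => (ρ x).toNNReal := hρm.real_toNNReal
  have he : ∀ x, (ρ x).toNNReal • f x = ρ x * f x := fun x => by
    rw [NNReal.smul_def, Real.coe_toNNReal _ (hρ0 x), smul_eq_mul]
  constructor
  · change Integrable f (μ.withDensity fun x => (((ρ x).toNNReal : NNReal) : ℝ≥0∞))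
    rw [integrable_withDensity_iff_integrable_smul hm]
    simp only [he]
    exact hρ.integrable_mul hf
  · change ∫ x, f x ∂(μ.withDensity fun x => (((ρ x).toNNReal : NNReal) : ℝ≥0∞)) = _
    rw [integral_withDensity_eq_integral_smul hm]
    simp only [he]

theorem sqDiffIntegral_withDensity {μ : Measure X} [IsFiniteMeasure μ] {ρ₁ ρ₂ : X → ℝ}
    (h₁ : MemLp ρ₁ 2 μ) (h₂ : MemLp ρ₂ 2 μ) (h₁m : Measurable ρ₁) (h₂m : Measurable ρ₂)
    (h₁0 : ∀ x, 0 ≤ ρ₁ x) (h₂0 : ∀ x, 0 ≤ ρ₂ x) :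
    sqDiffIntegral (μ.withDensity fun x => ENNReal.ofReal (ρ₁ x))
      (μ.withDensity fun x => ENNReal.ofReal (ρ₂ x)) μ
      = ENNReal.ofReal (∫ x, (ρ₁ x - ρ₂ x) ^ 2 ∂μ) := by
  have hf1 : IsFiniteMeasure (μ.withDensity fun x => ENNReal.ofReal (ρ₁ x)) :=
    isFiniteMeasure_withDensity_ofReal (h₁.integrable one_le_two).2
  have hf2 : IsFiniteMeasure (μ.withDensity fun x => ENNReal.ofReal (ρ₂ x)) :=
    isFiniteMeasure_withDensity_ofReal (h₂.integrable one_le_two).2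
  have hsq : Integrable (fun x => (ρ₁ x - ρ₂ x) ^ 2) μ := (h₁.sub h₂).integrable_sq
  rw [sqDiffIntegral_eq_of_ac _ _ _ (withDensity_absolutelyContinuous _ _)
    (withDensity_absolutelyContinuous _ _), ofReal_integral_eq_lintegral_ofReal
    hsq (Filter.Eventually.of_forall fun x => sq_nonneg _)]
  refine lintegral_congr_ae ?_
  filter_upwards [Measure.rnDeriv_withDensity μ h₁m.ennreal_ofReal,
    Measure.rnDeriv_withDensity μ h₂m.ennreal_ofReal] with x hx1 hx2
  rw [hx1, hx2, ENNReal.toReal_ofReal (h₁0 x), ENNReal.toReal_ofReal (h₂0 x)]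

end General

/-! ### Symmetrized products and their second moments -/

section PermSum

variable {n : ℕ}

/-- The symmetrization `(n!)⁻¹ ∑_π ∏ᵢ d_{π i}(xᵢ)`. -/
noncomputable def permAverage (d : Fin n → X → ℝ) (x : Fin n → X) : ℝ :=
  (n.factorial : ℝ)⁻¹ * ∑ π : Equiv.Perm (Fin n), ∏ i, d (π i) (x i)

theorem measurable_permAverage {d : Fin n → X → ℝ} (hd : ∀ i, Measurable (d i)) :
    Measurable (permAverage d) := by
  unfold permAverage
  refine measurable_const.mul (Finset.measurable_fun_sum _ fun π _ =>
    Finset.measurable_fun_prod _ fun i _ => (hd _).comp (measurable_pi_apply i))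

theorem permAverage_nonneg {Y : Type*} {d : Fin n → Y → ℝ} (hd : ∀ i x, 0 ≤ d i x) (x : Fin n → Y) :
    0 ≤ permAverage d x :=
  mul_nonneg (by positivity) (Finset.sum_nonneg fun _ _ => Finset.prod_nonneg fun _ _ => hd _ _)

variable {μ : Measure X} [IsProbabilityMeasure μ]

theorem memLp_prod_comp {d : Fin n → X → ℝ} (hd : ∀ i, MemLp (d i) 2 μ)
    (hdm : ∀ i, Measurable (d i)) :
    MemLp (fun x : Fin n → X => ∏ i, d i (x i)) 2 (Measure.pi fun _ => μ) := by
  have hm : Measurable fun x : Fin n → X => ∏ i, d i (x i) :=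
    Finset.measurable_fun_prod _ fun i _ => (hdm _).comp (measurable_pi_apply i)
  rw [memLp_two_iff_integrable_sq hm.aestronglyMeasurable]
  simp only [← Finset.prod_pow]
  exact Integrable.fintype_prod (f := fun i x => d i x ^ 2) fun i => (hd i).integrable_sq

theorem memLp_permAverage {d : Fin n → X → ℝ} (hd : ∀ i, MemLp (d i) 2 μ)
    (hdm : ∀ i, Measurable (d i)) : MemLp (permAverage d) 2 (Measure.pi fun _ => μ) := by
  unfold permAverage
  exact (memLp_finsetSum _ fun π _ =>
    memLp_prod_comp (fun i => hd (π i)) fun i => hdm (π i)).const_mul _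

/-- The second moment of a symmetrized product is a permanent. -/
theorem integral_permAverage_sq {d : Fin n → X → ℝ} (hd : ∀ i, MemLp (d i) 2 μ) :
    ∫ x, permAverage d x ^ 2 ∂(Measure.pi fun _ => μ)
      = (n.factorial : ℝ)⁻¹ * ∑ σ : Equiv.Perm (Fin n), ∏ i, ∫ y, d i y * d (σ i) y ∂μ := by
  have hI : ∀ π τ : Equiv.Perm (Fin n), Integrable
      (fun x : Fin n → X => ∏ i, (d (π i) (x i) * d (τ i) (x i))) (Measure.pi fun _ => μ) :=
    fun π τ => Integrable.fintype_prod (f := fun i x => d (π i) x * d (τ i) x)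
      fun i => (hd _).integrable_mul (hd _)
  have e : ∀ x, permAverage d x ^ 2 = ((n.factorial : ℝ)⁻¹) ^ 2 *
      ∑ π : Equiv.Perm (Fin n), ∑ τ : Equiv.Perm (Fin n),
        ∏ i, (d (π i) (x i) * d (τ i) (x i)) := by
    intro x
    rw [permAverage, mul_pow, sq (∑ π : Equiv.Perm (Fin n), _), Finset.sum_mul_sum]
    simp only [Finset.prod_mul_distrib]
  simp only [e]
  rw [integral_const_mul, integral_finsetSum _ fun π _ => integrable_finsetSum _ fun τ _ => hI π τ]
  have h : ∀ π : Equiv.Perm (Fin n), ∫ x : Fin n → X, ∑ τ : Equiv.Perm (Fin n),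
      ∏ i, (d (π i) (x i) * d (τ i) (x i)) ∂(Measure.pi fun _ => μ)
      = ∑ σ : Equiv.Perm (Fin n), ∏ i, ∫ y, d i y * d (σ i) y ∂μ := by
    intro π
    rw [integral_finsetSum _ fun τ _ => hI π τ]
    -- The summand depends on (π, τ) only through τπ⁻¹, so the double sum is n! copies of a single
    -- one.
    refine Fintype.sum_equiv (Equiv.mulRight π⁻¹) _ _ fun τ => ?_
    rw [integral_fintype_prod_eq_prod (fun i x => d (π i) x * d (τ i) x),
      ← Equiv.prod_comp π fun i => ∫ y, d i y * d ((Equiv.mulRight π⁻¹ τ) i) y ∂μ]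
    simp
  simp only [h, Finset.sum_const, Finset.card_univ, Fintype.card_perm, Fintype.card_fin,
    nsmul_eq_mul]
  have : (n.factorial : ℝ) ≠ 0 := by positivity
  field_simp

/-- Each product is linear in the single factor carrying i₀, which sits at position π⁻¹ i₀. -/
theorem permAverage_sub {Y : Type*} {p q : Fin n → Y → ℝ} (i₀ : Fin n) (h : ∀ i, i ≠ i₀ → q i = p i)
    (x : Fin n → Y) : permAverage p x - permAverage q x
      = permAverage (fun i => if i = i₀ then fun y => p i y - q i y else p i) x := by
  rw [permAverage, permAverage, permAverage, ← mul_sub, ← Finset.sum_sub_distrib]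
  congr 1
  refine Finset.sum_congr rfl fun π _ => ?_
  have key : ∀ f : Fin n → Y → ℝ, ∏ i, f (π i) (x i) = f i₀ (x (π⁻¹ i₀)) *
      ∏ i ∈ Finset.univ.erase (π⁻¹ i₀), f (π i) (x i) := fun f => by
    rw [← Finset.mul_prod_erase _ _ (Finset.mem_univ (π⁻¹ i₀))]
    simp
  have hne : ∀ i ∈ Finset.univ.erase (π⁻¹ i₀), π i ≠ i₀ := fun i hi hii =>
    Finset.ne_of_mem_erase hi (by rw [← hii]; simp)
  rw [key p, key q, key fun i => if i = i₀ then fun y => p i y - q i y else p i]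
  have e1 : ∏ i ∈ Finset.univ.erase (π⁻¹ i₀), q (π i) (x i)
      = ∏ i ∈ Finset.univ.erase (π⁻¹ i₀), p (π i) (x i) :=
    Finset.prod_congr rfl fun i hi => congrFun (h _ (hne i hi)) (x i)
  have e2 : ∏ i ∈ Finset.univ.erase (π⁻¹ i₀),
      (if π i = i₀ then fun y => p (π i) y - q (π i) y else p (π i)) (x i)
      = ∏ i ∈ Finset.univ.erase (π⁻¹ i₀), p (π i) (x i) :=
    Finset.prod_congr rfl fun i hi => by rw [if_neg (hne i hi)]
  rw [e1, e2, if_pos rfl]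
  ring

theorem permMixture_eq_withDensity (P : Fin n → ProbabilityMeasure X)
    (hP : ∀ i, (P i : Measure X) ≪ μ) :
    permMixture P = (Measure.pi fun _ : Fin n => μ).withDensity fun x =>
      ENNReal.ofReal (permAverage (fun i y => ((P i : Measure X).rnDeriv μ y).toReal) x) := by
  set p : Fin n → X → ℝ := fun i y => ((P i : Measure X).rnDeriv μ y).toReal with hp
  have hpi : ∀ i, Integrable (p i) μ := fun i => Measure.integrable_toReal_rnDeriv
  have hp0 : ∀ i x, 0 ≤ p i x := fun i x => ENNReal.toReal_nonneg
  have hpm : ∀ i, Measurable (p i) := fun i => by fun_prop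
  have h1 : ∀ π : Equiv.Perm (Fin n), Measure.pi (fun i => (P (π i) : Measure X))
      = (Measure.pi fun _ : Fin n => μ).withDensity
        fun x => ENNReal.ofReal (∏ i, p (π i) (x i)) := by
    intro π
    rw [← pi_withDensity_ofReal μ (fun i => p (π i)) (fun i => hpi _) fun i => hp0 _]
    congr 1
    funext i
    exact (withDensity_ofReal_eq _ μ (hP (π i))).symm
  have hm : ∀ π : Equiv.Perm (Fin n), Measurable fun x : Fin n → X =>
      ENNReal.ofReal (∏ i, p (π i) (x i)) := fun π =>
    (Finset.measurable_fun_prod _ fun i _ =>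
      (hpm _).comp (measurable_pi_apply i)).ennreal_ofReal
  ext s hs
  rw [permMixture, withDensity_apply _ hs]
  simp only [h1, Measure.smul_apply, Measure.finsetSum_apply, withDensity_apply _ hs, smul_eq_mul]
  rw [← lintegral_finsetSum _ fun π _ => hm π, ← lintegral_const_mul _ (by fun_prop)]
  refine lintegral_congr fun x => ?_
  rw [permAverage, ENNReal.ofReal_mul (by positivity), ENNReal.ofReal_inv_of_pos (by positivity),
    ENNReal.ofReal_natCast, ENNReal.ofReal_sum_of_nonneg fun π _ =>
      Finset.prod_nonneg fun i _ => hp0 _ _]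

end PermSum

end PermMix

/-! ### The uniform prior and the second moment bound -/

namespace PermMix

variable {X : Type*} [MeasurableSpace X] {n : ℕ}

section Prior

theorem card_erase_eq (i₀ : Fin n) : (Finset.univ.erase i₀).card = n - 1 := by
  rw [Finset.card_erase_of_mem (Finset.mem_univ i₀), Finset.card_univ, Fintype.card_fin]

/-- The uniform prior on the components other than the one at `i₀`. -/
theorem exists_uniform_prior (F : Set (ProbabilityMeasure X)) (hn : 2 ≤ n)
    (P : Fin n → ProbabilityMeasure X) (i₀ : Fin n) (hP : ∀ i, P i ∈ F) :
    ∃ ρ : @Measure F ⊤, @IsProbabilityMeasure F ⊤ ρ ∧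
      @Measure.bind F X ⊤ _ ρ (fun R => ((R : ProbabilityMeasure X) : Measure X))
        = avgExcept P i₀ ∧
      ∀ h : F → ℝ≥0∞, @lintegral F ⊤ ρ h
        = ((n - 1 : ℕ) : ℝ≥0∞)⁻¹ * ∑ i ∈ Finset.univ.erase i₀, h ⟨P i, hP i⟩ := by
  -- With the discrete σ-algebra every function on F is measurable, and the capacity allows it.
  let _ : MeasurableSpace F := ⊤
  have hl : ∀ h : F → ℝ≥0∞, ∫⁻ R, h R ∂(((n - 1 : ℕ) : ℝ≥0∞)⁻¹ •
      ∑ i ∈ Finset.univ.erase i₀, Measure.dirac (⟨P i, hP i⟩ : F))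
      = ((n - 1 : ℕ) : ℝ≥0∞)⁻¹ * ∑ i ∈ Finset.univ.erase i₀, h ⟨P i, hP i⟩ := by
    intro h
    rw [lintegral_smul_measure, lintegral_finsetSum_measure, smul_eq_mul]
    congr 1
    exact Finset.sum_congr rfl fun i _ => lintegral_dirac' _ measurable_from_top
  have h1 : ((n - 1 : ℕ) : ℝ≥0∞)⁻¹ * ((n - 1 : ℕ) : ℝ≥0∞) = 1 :=
    ENNReal.inv_mul_cancel (Nat.cast_ne_zero.mpr (by omega)) (ENNReal.natCast_ne_top _)
  refine ⟨((n - 1 : ℕ) : ℝ≥0∞)⁻¹ • ∑ i ∈ Finset.univ.erase i₀,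
    Measure.dirac (⟨P i, hP i⟩ : F), ⟨?_⟩, ?_, hl⟩
  · rw [← lintegral_one, hl]
    simp only [Finset.sum_const, card_erase_eq, nsmul_eq_mul, mul_one]
    exact h1
  · ext s hs
    rw [Measure.bind_apply hs measurable_from_top.aemeasurable, hl, avgExcept]
    simp

theorem isProbabilityMeasure_avgExcept (hn : 2 ≤ n) (P : Fin n → ProbabilityMeasure X)
    (i₀ : Fin n) : IsProbabilityMeasure (avgExcept P i₀) := by
  obtain ⟨ρ, hρ, hb, -⟩ := exists_uniform_prior Set.univ hn P i₀ fun _ => Set.mem_univ _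
  rw [← hb]
  let _ : MeasurableSpace (Set.univ : Set (ProbabilityMeasure X)) := ⊤
  exact isProbabilityMeasure_bind ρ measurable_from_top fun R => inferInstance

theorem chiSq_avgExcept_le (F : Set (ProbabilityMeasure X)) (hD : chiSqDiam F ≠ ∞) (hn : 2 ≤ n)
    (P : Fin n → ProbabilityMeasure X) (i₀ : Fin n) (hP : ∀ i, P i ∈ F)
    (R : ProbabilityMeasure X) (hR : R ∈ F) :
    chiSq (R : Measure X) (avgExcept P i₀) ≤ chiSqDiam F := by
  obtain ⟨ρ, hρ, hb, -⟩ := exists_uniform_prior F hn P i₀ hP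
  rw [← hb]
  let _ : MeasurableSpace F := ⊤
  exact chiSq_bind_le ρ measurable_from_top (fun R => inferInstance) _ hD fun R' =>
    le_iSup₂_of_le R hR (le_iSup₂_of_le R'.1 R'.2 le_rfl)

theorem sum_chiSq_le_chiSqCapacity (F : Set (ProbabilityMeasure X)) (hn : 2 ≤ n)
    (P : Fin n → ProbabilityMeasure X) (i₀ : Fin n) (hP : ∀ i, P i ∈ F) :
    ∑ i ∈ Finset.univ.erase i₀, chiSq (P i : Measure X) (avgExcept P i₀)
      ≤ ((n - 1 : ℕ) : ℝ≥0∞) * chiSqCapacity F := by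
  obtain ⟨ρ, hρ, hb, hl⟩ := exists_uniform_prior F hn P i₀ hP
  have h : @chiSqInfo X F _ ⊤ ρ (fun R => ((R : ProbabilityMeasure X) : Measure X))
      ≤ chiSqCapacity F := by
    exact le_iSup_of_le ⊤ (le_iSup_of_le measurable_from_top (le_iSup_of_le ρ
      (le_iSup_of_le hρ le_rfl)))
  unfold chiSqInfo at h
  rw [hl, hb] at h
  have h0 : ((n - 1 : ℕ) : ℝ≥0∞) ≠ 0 := Nat.cast_ne_zero.mpr (by omega)
  calc _ = ((n - 1 : ℕ) : ℝ≥0∞) * (((n - 1 : ℕ) : ℝ≥0∞)⁻¹ *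
        ∑ i ∈ Finset.univ.erase i₀, chiSq (P i : Measure X) (avgExcept P i₀)) := by
        rw [← mul_assoc, ENNReal.mul_inv_cancel h0 (ENNReal.natCast_ne_top _), one_mul]
    _ ≤ _ := by gcongr

theorem sum_integral_eq_avgExcept (hn : 2 ≤ n) (P : Fin n → ProbabilityMeasure X) (i₀ : Fin n)
    (f : X → ℝ) (hf : ∀ i, Integrable f (P i : Measure X)) :
    ∑ i ∈ Finset.univ.erase i₀, ∫ x, f x ∂(P i : Measure X)
      = ((n - 1 : ℕ) : ℝ) * ∫ x, f x ∂(avgExcept P i₀) := by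
  rw [avgExcept, integral_smul_measure, integral_finsetSum_measure fun i _ => hf i,
    ENNReal.toReal_inv, ENNReal.toReal_natCast, smul_eq_mul, ← mul_assoc, mul_inv_cancel₀, one_mul]
  exact Nat.cast_ne_zero.mpr (by omega)

end Prior

section Densities

variable {μ : Measure X} [IsProbabilityMeasure μ]

theorem memLp_rnDeriv_of_chiSq (R : Measure X) [IsProbabilityMeasure R] (h : chiSq R μ ≠ ∞) :
    MemLp (fun x => (R.rnDeriv μ x).toReal) 2 μ := by
  have hR := absolutelyContinuous_of_chiSq_ne_top R μ h
  rw [memLp_two_iff_integrable_sq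
    (Measure.measurable_rnDeriv R μ).ennreal_toReal.aestronglyMeasurable]
  have : ∫⁻ x, R.rnDeriv μ x ^ 2 ∂μ ≠ ∞ := by
    rw [lintegral_rnDeriv_sq R μ hR]
    exact ENNReal.add_ne_top.mpr ⟨ENNReal.one_ne_top, h⟩
  simpa only [ENNReal.toReal_pow] using integrable_toReal_of_lintegral_ne_top (by fun_prop) this

theorem integral_rnDeriv_sub_one_sq (R : Measure X) [IsProbabilityMeasure R]
    (h : chiSq R μ ≠ ∞) :
    ∫ x, ((R.rnDeriv μ x).toReal - 1) ^ 2 ∂μ = (chiSq R μ).toReal := by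
  rw [chiSq_eq_of_ac R μ (absolutelyContinuous_of_chiSq_ne_top R μ h),
    integral_eq_lintegral_of_nonneg_ae (Filter.Eventually.of_forall fun x => sq_nonneg _)
      (((Measure.measurable_rnDeriv R μ).ennreal_toReal.sub_const 1).pow_const
        2).aestronglyMeasurable]

theorem integral_rnDeriv_toReal (R : Measure X) [IsProbabilityMeasure R] (h : R ≪ μ) :
    ∫ x, (R.rnDeriv μ x).toReal ∂μ = 1 := by
  rw [Measure.integral_toReal_rnDeriv h]
  simp

/-- The affinity ∫ √(pq) dμ equals 1 - H²/2, and its square is at most ∫ pq dμ by Cauchy–Schwarz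
against the constant 1. This supplies the entrywise lower bound behind the spectral gap. -/
theorem sq_le_integral_rnDeriv_mul (R S : Measure X) [IsProbabilityMeasure R]
    [IsProbabilityMeasure S] (hR : R ≪ μ) (hS : S ≪ μ)
    (hR2 : MemLp (fun x => (R.rnDeriv μ x).toReal) 2 μ)
    (hS2 : MemLp (fun x => (S.rnDeriv μ x).toReal) 2 μ) {r : ℝ} (hr : r ≤ 1)
    (h : hellingerSq R S ≤ ENNReal.ofReal (2 * r)) (hr0 : 0 ≤ r) :
    (1 - r) ^ 2 ≤ ∫ x, (R.rnDeriv μ x).toReal * (S.rnDeriv μ x).toReal ∂μ := by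
  set p := fun x => (R.rnDeriv μ x).toReal with hp
  set q := fun x => (S.rnDeriv μ x).toReal with hq
  have hp0 : ∀ x, 0 ≤ p x := fun x => ENNReal.toReal_nonneg
  have hq0 : ∀ x, 0 ≤ q x := fun x => ENNReal.toReal_nonneg
  have hpi : Integrable p μ := Measure.integrable_toReal_rnDeriv
  have hqi : Integrable q μ := Measure.integrable_toReal_rnDeriv
  have hs2 : MemLp (fun x => √(p x) * √(q x)) 2 μ := by
    rw [memLp_two_iff_integrable_sq (by fun_prop)]
    refine (hR2.integrable_mul hS2).congr (Filter.Eventually.of_forall fun x => ?_)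
    simp only [Pi.mul_apply, mul_pow, Real.sq_sqrt (hp0 x), Real.sq_sqrt (hq0 x)]
  have hs1 : Integrable (fun x => √(p x) * √(q x)) μ := hs2.integrable one_le_two
  have hexp : ∀ x, (√(p x) - √(q x)) ^ 2 = p x + q x - 2 * (√(p x) * √(q x)) := fun x => by
    rw [sub_sq, Real.sq_sqrt (hp0 x), Real.sq_sqrt (hq0 x)]
    ring
  have hi : Integrable (fun x => (√(p x) - √(q x)) ^ 2) μ := by
    simp only [hexp]
    exact (hpi.add hqi).sub (hs1.const_mul 2)
  have hH : ∫ x, (√(p x) - √(q x)) ^ 2 ∂μ ≤ 2 * r := by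
    rw [hellingerSq_eq R S μ hR hS,
      ← ofReal_integral_eq_lintegral_ofReal hi
        (Filter.Eventually.of_forall fun x => sq_nonneg _)] at h
    exact (ENNReal.ofReal_le_ofReal_iff (by linarith)).mp h
  have hb : 1 - r ≤ ∫ x, √(p x) * √(q x) ∂μ := by
    have hpq : Integrable (fun x => p x + q x) μ := hpi.add hqi
    simp only [hexp] at hH
    rw [integral_sub hpq (hs1.const_mul 2), integral_add hpi hqi, integral_const_mul,
      integral_rnDeriv_toReal R hR, integral_rnDeriv_toReal S hS] at hH
    linarith
  have hcs := sq_integral_mul_le μ hs2 (memLp_const (1 : ℝ))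
  simp only [mul_one, one_pow, integral_const, probReal_univ, smul_eq_mul, mul_pow,
    Real.sq_sqrt (hp0 _), Real.sq_sqrt (hq0 _)] at hcs
  exact (pow_le_pow_left₀ (by linarith) hb 2).trans hcs

end Densities

section Main

variable (F : Set (ProbabilityMeasure X))

/-- The second moment bound for a difference of two permutation mixtures. -/
theorem integral_permAverage_sub_sq_le (hD : chiSqDiam F ≠ ∞) (hn : 2 ≤ n)
    (P Q : Fin n → ProbabilityMeasure X) (i₀ : Fin n) (hP : ∀ i, P i ∈ F) (hQ : ∀ i, Q i ∈ F)
    (hPQ : ∀ i, i ≠ i₀ → Q i = P i) :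
    ∫ x, (permAverage (fun i y => ((P i : Measure X).rnDeriv (avgExcept P i₀) y).toReal) x
        - permAverage (fun i y => ((Q i : Measure X).rnDeriv (avgExcept P i₀) y).toReal) x) ^ 2
        ∂(Measure.pi fun _ : Fin n => avgExcept P i₀)
      ≤ 12 * (chiSqDiam F).toReal *
        (Real.exp 1 / (1 - (hellingerSqDiam F).toReal / 2) ^ 2) ^ (3 * (chiSqCapacity F).toReal)
        / n := by
  have hμ := isProbabilityMeasure_avgExcept hn P i₀
  set μ := avgExcept P i₀ with hμdef
  set p : Fin n → X → ℝ := fun i y => ((P i : Measure X).rnDeriv μ y).toReal with hp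
  set q : Fin n → X → ℝ := fun i y => ((Q i : Measure X).rnDeriv μ y).toReal with hq
  have hχ : ∀ R ∈ F, chiSq (R : Measure X) μ ≤ chiSqDiam F := fun R hR =>
    chiSq_avgExcept_le F hD hn P i₀ hP R hR
  have hχt : ∀ R ∈ F, chiSq (R : Measure X) μ ≠ ∞ := fun R hR => ne_top_of_le_ne_top hD (hχ R hR)
  have hac : ∀ R ∈ F, (R : Measure X) ≪ μ := fun R hR =>
    absolutelyContinuous_of_chiSq_ne_top _ _ (hχt R hR)
  have hp2 : ∀ i, MemLp (p i) 2 μ := fun i => memLp_rnDeriv_of_chiSq _ (hχt _ (hP i))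
  have hq2 : ∀ i, MemLp (q i) 2 μ := fun i => memLp_rnDeriv_of_chiSq _ (hχt _ (hQ i))
  have hp1 : ∀ i, ∫ x, p i x ∂μ = 1 := fun i => integral_rnDeriv_toReal _ (hac _ (hP i))
  have hq1 : ∀ i, ∫ x, q i x ∂μ = 1 := fun i => integral_rnDeriv_toReal _ (hac _ (hQ i))
  have hqp : ∀ i, i ≠ i₀ → q i = p i := fun i hi => by simp only [hp, hq, hPQ i hi]
  simp only [permAverage_sub i₀ hqp]
  set d : Fin n → X → ℝ := fun i => if i = i₀ then fun y => p i y - q i y else p i with hd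
  -- The mean of d_i; centring by it splits the Gram matrix into ε_i ε_j plus the covariance Γ.
  let ε : Fin n → ℝ := fun i => if i = i₀ then 0 else 1
  have hd2 : ∀ i, MemLp (d i) 2 μ := fun i => by
    simp only [hd]
    split_ifs
    · exact (hp2 i).sub (hq2 i)
    · exact hp2 i
  have hd1 : ∀ i, ∫ x, d i x ∂μ = ε i := fun i => by
    simp only [hd, ε]
    split_ifs
    · rw [integral_sub ((hp2 i).integrable one_le_two) ((hq2 i).integrable one_le_two), hp1, hq1,
        sub_self]
    · exact hp1 i
  let φ : Fin n → X → ℝ := fun i x => d i x - ε i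
  have hφ2 : ∀ i, MemLp (φ i) 2 μ := fun i => (hd2 i).sub (memLp_const _)
  let Γ : Matrix (Fin n) (Fin n) ℝ := fun i j => ∫ x, φ i x * φ j x ∂μ
  have hφI : ∀ i j, Integrable (fun x => φ i x * φ j x) μ := fun i j =>
    (hφ2 i).integrable_mul (hφ2 j)
  have hdI : ∀ i j, Integrable (fun x => d i x * d j x) μ := fun i j =>
    (hd2 i).integrable_mul (hd2 j)
  have hΓ : ∀ i j, ∫ x, d i x * d j x ∂μ = ε i * ε j + Γ i j := by
    intro i j
    have e : ∀ x, φ i x * φ j x = d i x * d j x - ε j * d i x - ε i * d j x + ε i * ε j :=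
      fun x => by simp only [φ]; ring
    have i1 := ((hd2 i).integrable one_le_two).const_mul (ε j)
    have i2 := ((hd2 j).integrable one_le_two).const_mul (ε i)
    have i3 : Integrable (fun x => d i x * d j x - ε j * d i x) μ := (hdI i j).sub i1
    have i4 : Integrable (fun x => d i x * d j x - ε j * d i x - ε i * d j x) μ := i3.sub i2
    simp only [Γ, e]
    rw [integral_add i4 (integrable_const _), integral_sub i3 i2, integral_sub (hdI i j) i1,
      integral_const_mul, integral_const_mul, hd1, hd1]
    simp
    ring
  have hPSD : Γ.PosSemidef := by
    refine Matrix.PosSemidef.of_dotProduct_mulVec_nonneg ?_ fun v => ?_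
    · ext i j
      rw [Matrix.conjTranspose_apply, star_trivial]
      simp only [Γ, mul_comm]
    · have h : star v ⬝ᵥ (Γ.mulVec v) = ∫ x, (∑ i, v i * φ i x) ^ 2 ∂μ := by
        have e : ∀ x, (∑ i, v i * φ i x) ^ 2
            = ∑ i, ∑ j, v i * (v j * (φ i x * φ j x)) := fun x => by
          rw [sq, Finset.sum_mul_sum]
          exact Finset.sum_congr rfl fun i _ => Finset.sum_congr rfl fun j _ => by ring
        simp only [e]
        rw [integral_finsetSum _ fun i _ => integrable_finsetSum _ fun j _ =>
          ((hφI i j).const_mul _).const_mul _]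
        simp only [dotProduct, Matrix.mulVec, star_trivial, Finset.mul_sum]
        refine Finset.sum_congr rfl fun i _ => ?_
        rw [integral_finsetSum _ fun j _ => ((hφI i j).const_mul _).const_mul _]
        refine Finset.sum_congr rfl fun j _ => ?_
        rw [integral_const_mul, integral_const_mul]
        simp only [Γ]
        ring
      rw [h]
      exact integral_nonneg fun x => sq_nonneg _
  obtain ⟨hr, -⟩ := hellingerSingularity_eq F hD
  set r := (hellingerSqDiam F).toReal / 2 with hrdef
  have hcard : ((Finset.univ.erase i₀).card : ℝ) = ((n - 1 : ℕ) : ℝ) := by rw [card_erase_eq]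
  have hpp : ∀ i ∈ Finset.univ.erase i₀, ∀ j ∈ Finset.univ.erase i₀,
      Γ i j + 1 = ∫ x, p i x * p j x ∂μ := by
    intro i hi j hj
    have h := hΓ i j
    simp only [ε, hd, if_neg (Finset.ne_of_mem_erase hi), if_neg (Finset.ne_of_mem_erase hj),
      mul_one] at h
    rw [h]
    ring
  -- Summing ∫ p_i dP_j over j ≠ i₀ gives N ∫ p_i dμ = N, which cancels the N subtracted ones.
  have hrow : ∀ i ∈ Finset.univ.erase i₀, ∑ j ∈ Finset.univ.erase i₀, Γ i j = 0 := by
    intro i hi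
    have hPint : ∀ j, Integrable (p i) (P j : Measure X) := fun j => by
      rw [← integrable_rnDeriv_smul_iff (hac _ (hP j))]
      exact (hp2 j).integrable_mul (hp2 i)
    have h1 : ∀ j ∈ Finset.univ.erase i₀, Γ i j = ∫ x, p i x ∂(P j : Measure X) - 1 := by
      intro j hj
      rw [eq_sub_iff_add_eq, hpp i hi j hj, ← integral_rnDeriv_smul (hac _ (hP j))]
      exact integral_congr_ae (Filter.Eventually.of_forall fun x => mul_comm _ _)
    rw [Finset.sum_congr rfl h1, Finset.sum_sub_distrib,
      sum_integral_eq_avgExcept hn P i₀ (p i) hPint, ← hμdef, hp1, Finset.sum_const,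
      nsmul_eq_mul, hcard]
    ring
  have hHne : hellingerSqDiam F ≠ ∞ := (hellingerSqDiam_lt_two F hD).ne_top
  have hgap : ∀ i ∈ Finset.univ.erase i₀, ∀ j ∈ Finset.univ.erase i₀,
      (1 - r) ^ 2 ≤ Γ i j + 1 := by
    intro i hi j hj
    rw [hpp i hi j hj]
    refine sq_le_integral_rnDeriv_mul _ _ (hac _ (hP i)) (hac _ (hP j)) (hp2 i) (hp2 j)
      (by linarith) ?_ (by positivity)
    rw [hrdef, mul_div_cancel₀ _ two_ne_zero, ENNReal.ofReal_toReal hHne]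
    exact le_iSup₂_of_le (P i) (hP i) (le_iSup₂_of_le (P j) (hP j) le_rfl)
  have hCne : chiSqCapacity F ≠ ∞ := ne_top_of_le_ne_top hD (chiSqCapacity_le_chiSqDiam F hD)
  have htr : ∑ i ∈ Finset.univ.erase i₀, Γ i i
      ≤ (Finset.univ.erase i₀).card * (chiSqCapacity F).toReal := by
    have h1 : ∀ i ∈ Finset.univ.erase i₀, Γ i i = (chiSq (P i : Measure X) μ).toReal := by
      intro i hi
      rw [← integral_rnDeriv_sub_one_sq _ (hχt _ (hP i))]
      simp only [Γ, φ, ε, hd, if_neg (Finset.ne_of_mem_erase hi), ← sq]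
      rfl
    have h2 := sum_chiSq_le_chiSqCapacity F hn P i₀ hP
    have h3 := ENNReal.toReal_mono (ENNReal.mul_ne_top (ENNReal.natCast_ne_top _) hCne) h2
    rw [ENNReal.toReal_sum fun i _ => hχt _ (hP i), ENNReal.toReal_mul,
      ENNReal.toReal_natCast] at h3
    rw [Finset.sum_congr rfl h1, hcard]
    exact h3
  have hne : (Finset.univ.erase i₀).Nonempty := by
    rw [← Finset.card_pos, card_erase_eq]
    omega
  have hmain := sum_perm_prod_le i₀ Γ hPSD hne (by positivity) hrow hgap htr
  -- (p - q)² ≤ 2(p - 1)² + 2(q - 1)², and each square integrates to a χ² divergence from μ, at most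
  -- the diameter.
  have h00 : Γ i₀ i₀ ≤ 4 * (chiSqDiam F).toReal := by
    have e : Γ i₀ i₀ = ∫ x, (p i₀ x - q i₀ x) ^ 2 ∂μ := by
      simp only [Γ, φ, ε, hd, if_true, sub_zero, ← sq]
    have m1 : MemLp (fun x => p i₀ x - 1) 2 μ := (hp2 i₀).sub (memLp_const _)
    have m2 : MemLp (fun x => q i₀ x - 1) 2 μ := (hq2 i₀).sub (memLp_const _)
    have hle : ∫ x, (p i₀ x - q i₀ x) ^ 2 ∂μ
        ≤ ∫ x, (2 * (p i₀ x - 1) ^ 2 + 2 * (q i₀ x - 1) ^ 2) ∂μ := by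
      refine integral_mono ((hp2 i₀).sub (hq2 i₀)).integrable_sq
        ((m1.integrable_sq.const_mul 2).add (m2.integrable_sq.const_mul 2)) fun x => ?_
      change (p i₀ x - q i₀ x) ^ 2 ≤ 2 * (p i₀ x - 1) ^ 2 + 2 * (q i₀ x - 1) ^ 2
      nlinarith [sq_nonneg (p i₀ x + q i₀ x - 2)]
    rw [integral_add (m1.integrable_sq.const_mul 2) (m2.integrable_sq.const_mul 2),
      integral_const_mul, integral_const_mul, integral_rnDeriv_sub_one_sq _ (hχt _ (hP i₀)),
      integral_rnDeriv_sub_one_sq _ (hχt _ (hQ i₀))] at hle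
    have b1 := ENNReal.toReal_mono hD (hχ _ (hP i₀))
    have b2 := ENNReal.toReal_mono hD (hχ _ (hQ i₀))
    rw [e]
    linarith
  rw [integral_permAverage_sq hd2]
  simp only [hΓ]
  have hfac : (n.factorial : ℝ) = n * ((n - 1).factorial : ℝ) := by
    rw [← Nat.mul_factorial_pred (by omega : n ≠ 0)]
    push_cast
    rfl
  have hn0 : (0 : ℝ) < n := by
    have : 0 < n := by omega
    exact_mod_cast this
  set G := (Real.exp 1 / (1 - r) ^ 2) ^ (3 * (chiSqCapacity F).toReal) with hG
  have hG0 : 0 ≤ G := Real.rpow_nonneg (by positivity) _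
  calc (n.factorial : ℝ)⁻¹ * ∑ σ : Equiv.Perm (Fin n), ∏ i, (ε i * ε (σ i) + Γ i (σ i))
      ≤ (n.factorial : ℝ)⁻¹ * ((n - 1).factorial * (Γ i₀ i₀ * (3 * G))) := by
        refine mul_le_mul_of_nonneg_left ?_ (by positivity)
        rw [card_erase_eq] at hmain
        exact hmain
    _ = Γ i₀ i₀ * (3 * G) / n := by
        rw [hfac]
        have : ((n - 1).factorial : ℝ) ≠ 0 := by positivity
        field_simp
    _ ≤ (4 * (chiSqDiam F).toReal) * (3 * G) / n := by gcongr
    _ = _ := by ring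

end Main

end PermMix

/-! ### Assembling the theorem in extended nonnegative reals -/

namespace PermMix

theorem singularity_rpow_bound_eq {X : Type*} [MeasurableSpace X] (F : Set (ProbabilityMeasure X))
    (hD : chiSqDiam F ≠ ∞) {n : ℕ} (hn : 0 < n) :
    12 * chiSqDiam F * (ENNReal.ofReal (Real.exp 1) * hellingerSingularity F)
        ^ (3 * (chiSqCapacity F).toReal) / (n : ℝ≥0∞)
      = ENNReal.ofReal (12 * (chiSqDiam F).toReal *
        (Real.exp 1 / (1 - (hellingerSqDiam F).toReal / 2) ^ 2)
          ^ (3 * (chiSqCapacity F).toReal) / n) := by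
  obtain ⟨hr, hs⟩ := hellingerSingularity_eq F hD
  have hn0 : (0 : ℝ) < n := by exact_mod_cast hn
  have hb : 0 < Real.exp 1 / (1 - (hellingerSqDiam F).toReal / 2) ^ 2 := by positivity
  rw [hs, ← ENNReal.ofReal_mul (Real.exp_pos 1).le, ← div_eq_mul_inv,
    ENNReal.ofReal_rpow_of_pos hb, ENNReal.ofReal_div_of_pos hn0, ENNReal.ofReal_natCast,
    ENNReal.ofReal_mul (by positivity), ENNReal.ofReal_mul (by norm_num),
    ENNReal.ofReal_toReal hD]
  norm_num

end PermMix

theorem theorem3 {X : Type*} [MeasurableSpace X] (F : Set (ProbabilityMeasure X))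
    (hD : PermMix.chiSqDiam F < ∞) :
    PermMix.chiSqCapacity F < ∞ ∧ PermMix.hellingerSingularity F < ∞ ∧
    ∀ (n : ℕ), 2 ≤ n → ∀ (P Q : Fin n → ProbabilityMeasure X) (i₀ : Fin n),
      (∀ i, P i ∈ F) → (∀ i, Q i ∈ F) → (∀ i, i ≠ i₀ → Q i = P i) →
      (PermMix.tvDist (PermMix.permMixture P) (PermMix.permMixture Q)) ^ 2
          ≤ (1 / 4) * PermMix.sqDiffIntegral (PermMix.permMixture P) (PermMix.permMixture Q)
              (Measure.pi fun _ : Fin n => PermMix.avgExcept P i₀) ∧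
      (1 / 4) * PermMix.sqDiffIntegral (PermMix.permMixture P) (PermMix.permMixture Q)
              (Measure.pi fun _ : Fin n => PermMix.avgExcept P i₀)
          ≤ 3 * PermMix.chiSqDiam F *
              (ENNReal.ofReal (Real.exp 1) * PermMix.hellingerSingularity F)
                ^ (3 * (PermMix.chiSqCapacity F).toReal) / (n : ℝ≥0∞) ∧
      ∀ f : (Fin n → X) → ℝ,
        MemLp f 2 (Measure.pi fun _ : Fin n => PermMix.avgExcept P i₀) →
        Integrable f (PermMix.permMixture P) ∧ Integrable f (PermMix.permMixture Q) ∧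
        ENNReal.ofReal
            ((∫ x, f x ∂(PermMix.permMixture P) - ∫ x, f x ∂(PermMix.permMixture Q)) ^ 2)
          ≤ ENNReal.ofReal (∫ x, f x ^ 2 ∂(Measure.pi fun _ : Fin n => PermMix.avgExcept P i₀)) *
              (12 * PermMix.chiSqDiam F *
                (ENNReal.ofReal (Real.exp 1) * PermMix.hellingerSingularity F)
                  ^ (3 * (PermMix.chiSqCapacity F).toReal) / (n : ℝ≥0∞)) := by
  have hDne := hD.ne
  obtain ⟨hr, hs⟩ := PermMix.hellingerSingularity_eq F hDne
  refine ⟨(PermMix.chiSqCapacity_le_chiSqDiam F hDne).trans_lt hD,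
    by rw [hs]; exact ENNReal.ofReal_lt_top, ?_⟩
  intro n hn P Q i₀ hP hQ hPQ
  have hμ := PermMix.isProbabilityMeasure_avgExcept hn P i₀
  have hb := PermMix.singularity_rpow_bound_eq F hDne (n := n) (by omega)
  have hmain := PermMix.integral_permAverage_sub_sq_le F hDne hn P Q i₀ hP hQ hPQ
  set μ := PermMix.avgExcept P i₀ with hμdef
  have hχ : ∀ R ∈ F, PermMix.chiSq (R : Measure X) μ ≠ ∞ := fun R hR =>
    ne_top_of_le_ne_top hDne (PermMix.chiSq_avgExcept_le F hDne hn P i₀ hP R hR)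
  have hac : ∀ R ∈ F, (R : Measure X) ≪ μ := fun R hR =>
    PermMix.absolutelyContinuous_of_chiSq_ne_top _ _ (hχ R hR)
  -- Both mixtures now have explicit L² densities with respect to μ^{⊗n}, so all three claims become
  -- statements about the difference of these densities.
  rw [PermMix.permMixture_eq_withDensity (μ := μ) P fun i => hac _ (hP i),
    PermMix.permMixture_eq_withDensity (μ := μ) Q fun i => hac _ (hQ i)]
  have hdens : ∀ R : Fin n → ProbabilityMeasure X, (∀ i, R i ∈ F) →
      MemLp (PermMix.permAverage fun i y => ((R i : Measure X).rnDeriv μ y).toReal) 2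
        (Measure.pi fun _ : Fin n => μ) ∧
      Measurable (PermMix.permAverage fun i y => ((R i : Measure X).rnDeriv μ y).toReal) ∧
      ∀ x, 0 ≤ PermMix.permAverage (fun i y => ((R i : Measure X).rnDeriv μ y).toReal) x := by
    intro R hR
    have hm : ∀ i, Measurable fun y => ((R i : Measure X).rnDeriv μ y).toReal := fun i => by
      fun_prop
    exact ⟨PermMix.memLp_permAverage (fun i => PermMix.memLp_rnDeriv_of_chiSq _ (hχ _ (hR i))) hm,
      PermMix.measurable_permAverage hm,
      PermMix.permAverage_nonneg fun i x => ENNReal.toReal_nonneg⟩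
  obtain ⟨hP2, hPm, hP0⟩ := hdens P hP
  obtain ⟨hQ2, hQm, hQ0⟩ := hdens Q hQ
  set a := PermMix.permAverage fun i y => ((P i : Measure X).rnDeriv μ y).toReal with ha
  set b := PermMix.permAverage fun i y => ((Q i : Measure X).rnDeriv μ y).toReal with hbd
  have hsq := PermMix.sqDiffIntegral_withDensity hP2 hQ2 hPm hQm hP0 hQ0
  have hfP : IsFiniteMeasure ((Measure.pi fun _ : Fin n => μ).withDensity
      fun x => ENNReal.ofReal (a x)) :=
    isFiniteMeasure_withDensity_ofReal (hP2.integrable one_le_two).2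
  have hfQ : IsFiniteMeasure ((Measure.pi fun _ : Fin n => μ).withDensity
      fun x => ENNReal.ofReal (b x)) :=
    isFiniteMeasure_withDensity_ofReal (hQ2.integrable one_le_two).2
  refine ⟨PermMix.tvDist_sq_le _ _ _ (withDensity_absolutelyContinuous _ _)
    (withDensity_absolutelyContinuous _ _), ?_, fun f hf => ?_⟩
  · rw [hsq]
    have h12 : (12 : ℝ≥0∞) = 4 * 3 := by norm_num
    calc (1 / 4 : ℝ≥0∞) * ENNReal.ofReal (∫ x, (a x - b x) ^ 2 ∂(Measure.pi fun _ => μ))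
        ≤ (1 / 4) * (12 * PermMix.chiSqDiam F *
            (ENNReal.ofReal (Real.exp 1) * PermMix.hellingerSingularity F)
              ^ (3 * (PermMix.chiSqCapacity F).toReal) / (n : ℝ≥0∞)) := by
          rw [hb]
          gcongr
      _ = ((1 / 4) * 4) * (3 * PermMix.chiSqDiam F *
            (ENNReal.ofReal (Real.exp 1) * PermMix.hellingerSingularity F)
              ^ (3 * (PermMix.chiSqCapacity F).toReal) / (n : ℝ≥0∞)) := by
          rw [h12]
          simp only [div_eq_mul_inv]
          ring
      _ = _ := by
          rw [ENNReal.div_mul_cancel (by norm_num) (by norm_num), one_mul]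
  · obtain ⟨hI1, hE1⟩ := PermMix.integrable_and_integral_withDensity hP2 hPm hP0 hf
    obtain ⟨hI2, hE2⟩ := PermMix.integrable_and_integral_withDensity hQ2 hQm hQ0 hf
    refine ⟨hI1, hI2, ?_⟩
    have i1 : Integrable (fun x => a x * f x) (Measure.pi fun _ : Fin n => μ) :=
      hP2.integrable_mul hf
    have i2 : Integrable (fun x => b x * f x) (Measure.pi fun _ : Fin n => μ) :=
      hQ2.integrable_mul hf
    have hab : MemLp (fun x => a x - b x) 2 (Measure.pi fun _ : Fin n => μ) := hP2.sub hQ2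
    rw [hb, hE1, hE2, ← integral_sub i1 i2,
      ← ENNReal.ofReal_mul (integral_nonneg fun x => sq_nonneg _)]
    refine ENNReal.ofReal_le_ofReal ?_
    simp only [← sub_mul]
    calc _ ≤ _ := PermMix.sq_integral_mul_le _ hab hf
      _ = _ := mul_comm _ _
      _ ≤ _ := mul_le_mul_of_nonneg_left hmain (integral_nonneg fun x => sq_nonneg _)
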